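/- **Setting.** A *stochastic graph* $G=(U,V,E)$ has finite sets $U$ of offline vertices and $V\neq\emptyset$ of online vertices, $E=U\times V$, edge weights $w_e\in\mathbb{R}$, edge probabilities $p_e\in[0,1]$, and for each $v\in V$ an online probing constraint $\mathcal{C}_v$: a nonempty set of strings of distinct edges of $\partial(v)=U\times\{v\}$ that is downward-closed (closed under substrings and permutations). Each edge $e$ is active independently with probability $p_e$. *Benchmark.* An offline probing algorithm knows $G$, but not which edges are active. It adaptively (and possibly with randomization) probes edges in any order; probing $e$ reveals whether $e$ is active, and if it is, the algorithm must decide irrevocably, before the next probe, whether to include $e$ in its matching, which is allowed only if both endpoints of $e$ are unmatched. For each $v$, the edges of $\partial(v)$ that are probed must form, in order, a string of $\mathcal{C}_v$. $\mathrm{OPT}(G)$ is the largest expected weight $\mathbb{E}[w(\mathcal M)]$, $w(\mathcal M)=\sum_{e\in\mathcal M}w_e$, of the matching returned by an offline probing algorithm. *Configuration LP.* For a string $\boldsymbol e$, let $q(\boldsymbol e)=\prod_{f\in\boldsymbol e}(1-p_f)$, let $\boldsymbol e_{<f}$ be the part of $\boldsymbol e$ before $f$, and let $\mathrm{val}(\boldsymbol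 e)=\sum_{f\in\boldsymbol e}w_f\,p_f\,q(\boldsymbol e_{<f})$. LP-config for $G$ is: maximize $\sum_{v\in V}\sum_{\boldsymbol e\in\mathcal C_v}\mathrm{val}(\boldsymbol e)\,x_v(\boldsymbol e)$ subject to $$\sum_{v\in V}\ \sum_{\boldsymbol e\in\mathcal C_v:\,(u,v)\in\boldsymbol e}p_{u,v}\,q(\boldsymbol e_{<(u,v)})\,x_v(\boldsymbol e)\le 1\ \ (u\in U),\qquad \sum_{\boldsymbol e\in\mathcal C_v}x_v(\boldsymbol e)=1\ \ (v\in V),\qquad x_v(\boldsymbol e)\ge 0 .$$ *VertexProbe.* Given $v$ and $(x_v(\boldsymbol e))_{\boldsymbol e\in\mathcal C_v}$, draw $\boldsymbol e\in\mathcal C_v$ with probability $x_v(\boldsymbol e)$, probe the edges of $\boldsymbol e$ in order, and return the first edge found active, if there is one. *Algorithm.* Let $n=|V|$, let $v_1,\dots,v_n$ be the arrival order of $V$, let $V_t=\{v_1,\dots,v_t\}$, and let $G_t=G[U\cup V_t]$ be the induced stochastic graph. Start with $\mathcal M=\emptyset$. For $t=1,\dots,n$: if $t<\lfloor n/e\rfloor$,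 pass on $v_t$; otherwise compute an optimal solution $x$ of LP-config for $G_t$ (any one, as a function of $G_t$), run VertexProbe on $v_t$ and $(x_{v_t}(\boldsymbol e))_{\boldsymbol e\in\mathcal C_{v_t}}$ with fresh randomness, and if it returns an edge $(u,v_t)$ with $u$ unmatched, add this edge to $\mathcal M$. Return $\mathcal M$. **Theorem.** For every stochastic graph $G$ and every choice of the optimal LP solutions, the set $\mathcal M$ returned by the algorithm is always a matching of active edges of $G$, and if the vertices of $V$ arrive in uniformly random order, independent of all other randomness, then $$\mathbb{E}[w(\mathcal M)]\ \ge\ \left(\frac1e-\frac1{|V|}\right)\cdot\mathrm{OPT}(G).$$ -/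

import Mathlib

/-- A stochastic graph with offline vertices `U`, online vertices `V` and edge set `U × V`.
Every edge `(u, v)` has a weight `w u v` and is active independently with probability `p u v`.
A string of edges at the online vertex `v` is the list of its offline endpoints, and `C v` is the
downward-closed online probing constraint of `v`: a nonempty set of strings of distinct edges
that is closed under substrings and permutations. -/
structure StochasticGraph (U V : Type*) where
  w : U → V → ℝ
  p : U → V → ℝ
  p_nonneg : ∀ u v, 0 ≤ p u v
  p_le_one : ∀ u v, p u v ≤ 1
  C : V → Finset (List U)
  C_nonempty : ∀ v, (C v).Nonempty
  nodup_of_mem : ∀ v, ∀ l ∈ C v, l.Nodup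
  mem_of_sublist : ∀ v, ∀ l ∈ C v, ∀ l' : List U, l'.Sublist l → l' ∈ C v
  mem_of_perm : ∀ v, ∀ l ∈ C v, ∀ l' : List U, l'.Perm l → l' ∈ C v

/-- A set of edges is a matching if no two distinct edges of it share an endpoint. -/
def IsMatching {U V : Type*} (M : Finset (U × V)) : Prop :=
  ∀ e ∈ M, ∀ f ∈ M, (e.1 = f.1 ∨ e.2 = f.2) → e = f

/-- An adaptive, possibly randomized, probing algorithm in the probe-commit model, as a decision
tree. `halt` ends the execution, `coin r l m` continues with `l` with probability `r` and with `m`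
otherwise, and `probe e accept a b` probes the edge `e`: if `e` is active, then it is irrevocably
included in the matching if `accept` is `true` (and irrevocably discarded otherwise) and the
execution continues with `a`; if `e` is inactive, it continues with `b`. -/
inductive ProbingAlgorithm (U V : Type*) where
  | halt : ProbingAlgorithm U V
  | coin (r : unitInterval) (l m : ProbingAlgorithm U V) : ProbingAlgorithm U V
  | probe (e : U × V) (accept : Bool) (a b : ProbingAlgorithm U V) : ProbingAlgorithm U V

namespace StochasticGraph

/-- The induced stochastic graph on the offline vertices `U` and the online vertices in `S`. -/
def induce {U V : Type*} (G : StochasticGraph U V) (S : Finset V) : StochasticGraph U S where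
  w u v := G.w u v
  p u v := G.p u v
  p_nonneg u v := G.p_nonneg u v
  p_le_one u v := G.p_le_one u v
  C v := G.C v
  C_nonempty v := G.C_nonempty v
  nodup_of_mem v := G.nodup_of_mem v
  mem_of_sublist v := G.mem_of_sublist v
  mem_of_perm v := G.mem_of_perm v

/-- The probability that all edges of the string `l` at `v` are inactive. -/
def q {U V : Type*} (G : StochasticGraph U V) (v : V) (l : List U) : ℝ :=
  (l.map fun u => 1 - G.p u v).prod

/-- The part of the string `l` before (and excluding) its entry `u`. -/
def before {U : Type*} [DecidableEq U] (l : List U) (u : U) : List U :=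
  l.takeWhile fun u' => decide (u' ≠ u)

/-- The expected weight of the first active edge if the string `l` at `v` is probed in order. -/
def val {U V : Type*} [DecidableEq U] (G : StochasticGraph U V) (v : V) (l : List U) : ℝ :=
  (l.map fun u => G.w u v * G.p u v * G.q v (before l u)).sum

/-- A feasible solution of the configuration linear program of `G`. Only the values `x v l` with
`l ∈ G.C v` are variables of the program. -/
structure LPSolution {U V : Type*} [DecidableEq U] [Fintype V] (G : StochasticGraph U V) where
  x : V → List U → ℝ
  matching_le : ∀ u, ∑ v, ∑ l ∈ G.C v with u ∈ l, G.p u v * G.q v (before l u) * x v l ≤ 1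
  sum_eq_one : ∀ v, ∑ l ∈ G.C v, x v l = 1
  nonneg : ∀ v, ∀ l ∈ G.C v, 0 ≤ x v l

namespace LPSolution

/-- The objective value of a feasible solution of the configuration linear program. -/
def objective {U V : Type*} [DecidableEq U] [Fintype V] {G : StochasticGraph U V}
    (s : G.LPSolution) : ℝ :=
  ∑ v, ∑ l ∈ G.C v, G.val v l * s.x v l

/-- Optimality of a feasible solution of the configuration linear program. -/
def IsOptimal {U V : Type*} [DecidableEq U] [Fintype V] {G : StochasticGraph U V}
    (s : G.LPSolution) : Prop :=
  ∀ s' : G.LPSolution, s'.objective ≤ s.objective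

/-- The random string of `G.C v` that equals `l` with probability `x v l`. -/
noncomputable def draw {U V : Type*} [DecidableEq U] [Fintype V] {G : StochasticGraph U V}
    (s : G.LPSolution) (v : V) : PMF {l // l ∈ G.C v} :=
  PMF.ofFintype (fun l => ENNReal.ofReal (s.x v l)) (by
    rw [Finset.sum_coe_sort (G.C v) fun l => ENNReal.ofReal (s.x v l),
      ← ENNReal.ofReal_sum_of_nonneg (s.nonneg v), s.sum_eq_one v, ENNReal.ofReal_one])

/-- `VertexProbe` on the online vertex `v`, where `st u` is the state of the edge `(u, v)`: draw a
string of edges, probe its edges in order, and return (the offline endpoint of) the first edge that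
is revealed to be active, if there is one. -/
noncomputable def vertexProbe {U V : Type*} [DecidableEq U] [Fintype V] {G : StochasticGraph U V}
    (s : G.LPSolution) (v : V) (st : U → Bool) : PMF (Option U) :=
  (s.draw v).map fun l => l.1.find? st

end LPSolution

/-- The law of a biased coin, which is `true` with probability `r`. -/
noncomputable def biasedCoin (r : ℝ) (h0 : 0 ≤ r) (h1 : r ≤ 1) : PMF Bool :=
  PMF.ofFintype (fun b => if b then ENNReal.ofReal r else ENNReal.ofReal (1 - r)) (by
    rw [Fintype.sum_bool, if_pos rfl, if_neg Bool.false_ne_true,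
      ← ENNReal.ofReal_add h0 (sub_nonneg.2 h1), add_sub_cancel, ENNReal.ofReal_one])

/-- The joint law of the edge states: each edge `(u, v)` is active (its state is `true`)
independently with probability `p u v`. -/
noncomputable def edgeStates {U V : Type*} [Fintype U] [Fintype V] [DecidableEq U] [DecidableEq V]
    (G : StochasticGraph U V) : PMF (U × V → Bool) :=
  PMF.ofFintype
    (fun st => ∏ e : U × V,
      biasedCoin (G.p e.1 e.2) (G.p_nonneg e.1 e.2) (G.p_le_one e.1 e.2) (st e)) (by
    rw [← Fintype.prod_sum fun (e : U × V) (b : Bool) =>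
      biasedCoin (G.p e.1 e.2) (G.p_nonneg e.1 e.2) (G.p_le_one e.1 e.2) b]
    exact Finset.prod_eq_one fun e _ => (tsum_fintype _).symm.trans (PMF.tsum_coe _))

/-- The weight of a set of edges. -/
def weight {U V : Type*} (G : StochasticGraph U V) (M : Finset (U × V)) : ℝ :=
  ∑ e ∈ M, G.w e.1 e.2

/-- The expected weight of a random set of edges with law `μ`. -/
noncomputable def expectedWeight {U V : Type*} [Fintype U] [Fintype V] [DecidableEq U]
    [DecidableEq V] (G : StochasticGraph U V) (μ : PMF (Finset (U × V))) : ℝ :=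
  ∑ M : Finset (U × V), (μ M).toReal * G.weight M

/-! ### The offline adaptive benchmark -/

/-- `G.IsOffline T L M` says that the remaining execution `T` is that of an offline probing
algorithm on `G`, given that for each `v` the edges at `v` probed so far are, in order, `L v`, and
that the matching constructed so far is `M`: the string of probes at each `v` always belongs to
`C v` (so no edge is probed twice), and an edge is only accepted if both its endpoints are
unmatched. -/
def IsOffline {U V : Type*} [DecidableEq U] [DecidableEq V] (G : StochasticGraph U V) :
    ProbingAlgorithm U V → (V → List U) → Finset (U × V) → Prop
  | .halt, _, _ => True
  | .coin _ l m, L, M => G.IsOffline l L M ∧ G.IsOffline m L M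
  | .probe e accept a b, L, M =>
      L e.2 ++ [e.1] ∈ G.C e.2 ∧
      (accept = true → ∀ f ∈ M, f.1 ≠ e.1 ∧ f.2 ≠ e.2) ∧
      G.IsOffline a (Function.update L e.2 (L e.2 ++ [e.1])) (if accept then insert e M else M) ∧
      G.IsOffline b (Function.update L e.2 (L e.2 ++ [e.1])) M

end StochasticGraph

/-- The law of the matching returned by a probing algorithm that starts with the matching `M`, if
the edge states are `st`. -/
noncomputable def ProbingAlgorithm.run {U V : Type*} [DecidableEq U] [DecidableEq V]
    (st : U × V → Bool) : ProbingAlgorithm U V → Finset (U × V) → PMF (Finset (U × V))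
  | .halt, M => PMF.pure M
  | .coin r l m, M =>
      (StochasticGraph.biasedCoin r r.2.1 r.2.2).bind fun c => if c then l.run st M else m.run st M
  | .probe e accept a b, M =>
      if st e then a.run st (if accept then insert e M else M) else b.run st M

namespace StochasticGraph

/-- The offline adaptive benchmark `OPT(G)`: the largest expected weight of the matching returned
by an offline probing algorithm. -/
noncomputable def OPT {U V : Type*} [Fintype U] [Fintype V] [DecidableEq U] [DecidableEq V]
    (G : StochasticGraph U V) : ℝ :=
  sSup {r | ∃ T : ProbingAlgorithm U V, G.IsOffline T (fun _ => []) ∅ ∧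
    r = G.expectedWeight (G.edgeStates.bind fun st => T.run st ∅)}

/-! ### The online algorithm -/

/-- The set `V_t` of the first `t` arrivals, where the vertex `σ i` is the `(i + 1)`-st arrival and
`t = i + 1`. -/
def arrived {V : Type*} [Fintype V] [DecidableEq V] (σ : Fin (Fintype.card V) ≃ V)
    (i : Fin (Fintype.card V)) : Finset V :=
  (Finset.univ.filter fun j => j ≤ i).image σ

theorem mem_arrived {V : Type*} [Fintype V] [DecidableEq V] (σ : Fin (Fintype.card V) ≃ V)
    (i : Fin (Fintype.card V)) : σ i ∈ arrived σ i :=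
  Finset.mem_image_of_mem σ (by simp)

/-- Processing of the arrival number `t = i + 1`, if the current matching is `M`. Here `sol S` is
the solution of the configuration linear program that is computed for the induced stochastic graph
on the set `S` of the vertices that have arrived. -/
noncomputable def step {U V : Type*} [Fintype V] [DecidableEq U] [DecidableEq V]
    (G : StochasticGraph U V) (sol : ∀ S : Finset V, (G.induce S).LPSolution)
    (σ : Fin (Fintype.card V) ≃ V) (st : U × V → Bool) (i : Fin (Fintype.card V))
    (M : Finset (U × V)) : PMF (Finset (U × V)) :=
  if i.val + 1 < ⌊(Fintype.card V : ℝ) / Real.exp 1⌋₊ then PMF.pure M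
  else
    ((sol (arrived σ i)).vertexProbe ⟨σ i, mem_arrived σ i⟩ fun u => st (u, σ i)).map fun o =>
      match o with
      | none => M
      | some u => if ∀ f ∈ M, f.1 ≠ u then insert (u, σ i) M else M

/-- The law of the current matching after the first `t` arrivals, for the arrival order `σ` and the
edge states `st`. -/
noncomputable def matchingAfter {U V : Type*} [Fintype V] [DecidableEq U] [DecidableEq V]
    (G : StochasticGraph U V) (sol : ∀ S : Finset V, (G.induce S).LPSolution)
    (σ : Fin (Fintype.card V) ≃ V) (st : U × V → Bool) : ℕ → PMF (Finset (U × V))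
  | 0 => PMF.pure ∅
  | t + 1 =>
      (G.matchingAfter sol σ st t).bind fun M =>
        if h : t < Fintype.card V then G.step sol σ st ⟨t, h⟩ M else PMF.pure M

/-- The law of the matching returned by the online algorithm, for the arrival order `σ` and the
edge states `st`. -/
noncomputable def onlineMatching {U V : Type*} [Fintype V] [DecidableEq U] [DecidableEq V]
    (G : StochasticGraph U V) (sol : ∀ S : Finset V, (G.induce S).LPSolution)
    (σ : Fin (Fintype.card V) ≃ V) (st : U × V → Bool) : PMF (Finset (U × V)) :=
  G.matchingAfter sol σ st (Fintype.card V)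

/-- The law of a uniformly random order of the vertices. -/
noncomputable def randomOrder (V : Type*) [Fintype V] [DecidableEq V] :
    PMF (Fin (Fintype.card V) ≃ V) :=
  haveI : Nonempty (Fin (Fintype.card V) ≃ V) := ⟨(Fintype.equivFin V).symm⟩
  PMF.uniformOfFintype (Fin (Fintype.card V) ≃ V)

/-- The law of the matching returned by the online algorithm, if the vertices arrive in uniformly
random order, independently of the edge states. -/
noncomputable def onlineMatchingROM {U V : Type*} [Fintype U] [Fintype V] [DecidableEq U]
    [DecidableEq V] (G : StochasticGraph U V) (sol : ∀ S : Finset V, (G.induce S).LPSolution) :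
    PMF (Finset (U × V)) :=
  (randomOrder V).bind fun σ => G.edgeStates.bind fun st => G.onlineMatching sol σ st

end StochasticGraph

namespace StochasticGraph

theorem bddAbove_OPT {U V : Type*} [Fintype U] [Fintype V] [DecidableEq U] [DecidableEq V]
    (G : StochasticGraph U V) :
    BddAbove {r | ∃ T : ProbingAlgorithm U V, G.IsOffline T (fun _ => []) ∅ ∧
      r = G.expectedWeight (G.edgeStates.bind fun st => T.run st ∅)} := by
  refine ⟨∑ M : Finset (U × V), |G.weight M|, ?_⟩
  rintro r ⟨T, -, rfl⟩
  refine Finset.sum_le_sum fun M _ => ?_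
  have h1 : ((G.edgeStates.bind fun st => T.run st ∅) M).toReal ≤ 1 :=
    ENNReal.toReal_le_of_le_ofReal zero_le_one (by
      rw [ENNReal.ofReal_one]; exact PMF.coe_le_one _ M)
  calc _ ≤ _ * |G.weight M| := mul_le_mul_of_nonneg_left (le_abs_self _) ENNReal.toReal_nonneg
    _ ≤ 1 * |G.weight M| := mul_le_mul_of_nonneg_right h1 (abs_nonneg _)
    _ = _ := one_mul _

theorem exists_isOptimal {U V : Type*} [DecidableEq U] [Fintype V] (G : StochasticGraph U V) :
    ∃ s : G.LPSolution, s.IsOptimal := by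
  let obj : (V → List U → ℝ) → ℝ := fun x => ∑ v, ∑ l ∈ G.C v, G.val v l * x v l
  let K : Set (V → List U → ℝ) := {x | (∀ v l, x v l ∈ Set.Icc (0 : ℝ) 1) ∧
    (∀ u, ∑ v, ∑ l ∈ G.C v with u ∈ l, G.p u v * G.q v (before l u) * x v l ≤ 1) ∧
    ∀ v, ∑ l ∈ G.C v, x v l = 1}
  have hK : IsCompact K := by
    have h0 : IsCompact (Set.univ.pi fun _ : V => Set.univ.pi fun _ : List U => Set.Icc (0 : ℝ) 1) :=
      isCompact_univ_pi fun _ => isCompact_univ_pi fun _ => isCompact_Icc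
    refine h0.of_isClosed_subset ?_ fun x hx v _ l _ => hx.1 v l
    have h1 : K = (⋂ v, ⋂ l, {x | x v l ∈ Set.Icc (0 : ℝ) 1}) ∩
        ((⋂ u, {x | ∑ v, ∑ l ∈ G.C v with u ∈ l, G.p u v * G.q v (before l u) * x v l ≤ 1}) ∩
          ⋂ v, {x | ∑ l ∈ G.C v, x v l = 1}) := by
      ext x
      simp [K]
    rw [h1]
    exact (isClosed_iInter fun v => isClosed_iInter fun l => isClosed_Icc.preimage
      (by fun_prop : Continuous fun x : V → List U → ℝ => x v l)).inter
      ((isClosed_iInter fun u => isClosed_le (by fun_prop) continuous_const).inter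
        (isClosed_iInter fun v => isClosed_eq (by fun_prop) continuous_const))
  have hnil : ∀ v, [] ∈ G.C v := fun v =>
    let ⟨l, hl⟩ := G.C_nonempty v
    G.mem_of_sublist v l hl [] (List.nil_sublist l)
  have hne : K.Nonempty := by
    refine ⟨fun _ l => if l = [] then 1 else 0, fun v l => ?_, fun u => ?_, fun v => ?_⟩
    · dsimp only; split_ifs <;> simp
    · refine le_trans (le_of_eq (Finset.sum_eq_zero fun v _ => Finset.sum_eq_zero fun l hl => ?_))
        zero_le_one
      have : l ≠ [] := List.ne_nil_of_mem (Finset.mem_filter.1 hl).2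
      simp [this]
    · simp [hnil v]
  obtain ⟨x, hx, hmax⟩ := hK.exists_isMaxOn hne (f := obj) (by fun_prop)
  refine ⟨⟨x, hx.2.1, hx.2.2, fun v l _ => (hx.1 v l).1⟩, fun s => ?_⟩
  let y : V → List U → ℝ := fun v l => if l ∈ G.C v then s.x v l else 0
  have hy : ∀ v, ∀ l ∈ G.C v, y v l = s.x v l := fun v l hl => if_pos hl
  have hyK : y ∈ K := by
    refine ⟨fun v l => ?_, fun u => ?_, fun v => ?_⟩
    · by_cases hl : l ∈ G.C v
      · rw [hy v l hl]
        exact ⟨s.nonneg v l hl, s.sum_eq_one v ▸ Finset.single_le_sum (s.nonneg v) hl⟩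
      · simp [y, hl]
    · refine le_trans (le_of_eq ?_) (s.matching_le u)
      refine Finset.sum_congr rfl fun v _ => Finset.sum_congr rfl fun l hl => ?_
      rw [hy v l (Finset.mem_filter.1 hl).1]
    · rw [← s.sum_eq_one v]
      exact Finset.sum_congr rfl (hy v)
  have h := hmax hyK
  have e : s.objective = obj y :=
    Finset.sum_congr rfl fun v _ => Finset.sum_congr rfl fun l hl => by rw [hy v l hl]
  rw [e]
  exact h

end StochasticGraph

/-! For an LP solution let `hit v u` be the probability that `VertexProbe` on `v` returns `(u, v)`.
The vectors `hit v` that arise are exactly the points of the polytope `hitHull v`, spanned by the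
vectors `hitProb v l` with `l ∈ C v`. So the LP chooses a point of each polytope with row sums at
most 1, and its objective is linear in these points (`LPSolution.exists_of_mem_hitHull`,
`LPSolution.objective_eq`).

The LP bounds the benchmark (`OPT_le_of_isOptimal`): by induction on the decision tree, the
acceptance probabilities of an offline algorithm form such a choice
(`IsOffline.acceptProb_mem_convexHull`, `IsOffline.sum_acceptProb_le_one`). Weights may be negative,
but at an optimum every edge contributes a nonnegative amount, since zeroing a single coordinate
stays feasible (`LPSolution.IsOptimal.w_mul_hit_nonneg`).

For a fixed order, distinct arrivals use disjoint edges and fresh draws, so the events that they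
propose to `u` are independent. The gain from arrival `i` at `u` is thus its expected proposal times
the product of `1 - solHit` over the earlier proposing arrivals
(`expectedWeight_onlineMatchingROM_eq`). In random order, arrival `i` is uniform in the set of the
first `i + 1` arrivals, and restricting a global solution to that set is feasible. Hence the
proposals of arrival `i` are worth at least `OPT / n` (`objective_le_card_mul_mean`).

Revealing the order backwards, each factor at index `j` costs at most `j / (j + 1)`, because the hit
probabilities at `u` over `j + 1` vertices sum to at most 1. These factors telescope to `a / i`,
where `a = ⌊n/e⌋ - 1` is the first proposing index (`randomOrder_mean_mul_prod_ge`). What remains is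
`n/e - 1 ≤ a ∑ 1/i` over `a ≤ i < n` (`div_exp_sub_one_le_mul_sum_Ico`). -/

/-! ### Expectations over finite probability mass functions -/

namespace PMF

/-- The expectation of a real function under a probability mass function on a finite type. -/
noncomputable def mean {α : Type*} [Fintype α] (μ : PMF α) (f : α → ℝ) : ℝ :=
  ∑ a, (μ a).toReal * f a

theorem mean_pure {α : Type*} [Fintype α] (a : α) (f : α → ℝ) : (PMF.pure a).mean f = f a := by
  classical
  unfold mean
  rw [Finset.sum_eq_single a]
  · simp
  · intro b _ hb
    simp [PMF.pure_apply, hb]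
  · simp

theorem mean_bind {α β : Type*} [Fintype α] [Fintype β] (μ : PMF α) (κ : α → PMF β) (f : β → ℝ) :
    (μ.bind κ).mean f = μ.mean fun a => (κ a).mean f := by
  unfold mean
  have h : ∀ b, ((μ.bind κ) b).toReal = ∑ a, (μ a).toReal * (κ a b).toReal := fun b => by
    rw [PMF.bind_apply, tsum_fintype, ENNReal.toReal_sum]
    · simp [ENNReal.toReal_mul]
    · intro a _
      exact ENNReal.mul_ne_top (PMF.apply_ne_top _ _) (PMF.apply_ne_top _ _)
  simp_rw [h, Finset.sum_mul, Finset.mul_sum]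
  rw [Finset.sum_comm]
  simp_rw [mul_assoc]

theorem mean_map {α β : Type*} [Fintype α] [Fintype β] (μ : PMF α) (g : α → β) (f : β → ℝ) :
    (μ.map g).mean f = μ.mean (f ∘ g) := by
  rw [← PMF.bind_pure_comp, mean_bind]
  simp [mean_pure, Function.comp_def]

theorem sum_toReal {α : Type*} [Fintype α] (μ : PMF α) : ∑ a, (μ a).toReal = 1 := by
  rw [← ENNReal.toReal_sum fun a _ => PMF.apply_ne_top _ _, ← tsum_fintype (L := .unconditional α),
    PMF.tsum_coe, ENNReal.toReal_one]

theorem mean_const {α : Type*} [Fintype α] (μ : PMF α) (c : ℝ) : (μ.mean fun _ => c) = c := by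
  unfold mean
  rw [← Finset.sum_mul, sum_toReal, one_mul]

theorem mean_add {α : Type*} [Fintype α] (μ : PMF α) (f g : α → ℝ) :
    (μ.mean fun a => f a + g a) = μ.mean f + μ.mean g := by
  simp only [mean, mul_add, Finset.sum_add_distrib]

theorem mean_const_mul {α : Type*} [Fintype α] (μ : PMF α) (c : ℝ) (f : α → ℝ) :
    (μ.mean fun a => c * f a) = c * μ.mean f := by
  simp only [mean, Finset.mul_sum, mul_left_comm]

theorem mean_mul_const {α : Type*} [Fintype α] (μ : PMF α) (c : ℝ) (f : α → ℝ) :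
    (μ.mean fun a => f a * c) = μ.mean f * c := by
  simp only [mean, Finset.sum_mul, mul_assoc]

theorem mean_sum {α ι : Type*} [Fintype α] (μ : PMF α) (s : Finset ι) (f : ι → α → ℝ) :
    (μ.mean fun a => ∑ i ∈ s, f i a) = ∑ i ∈ s, μ.mean (f i) := by
  simp only [mean, Finset.mul_sum]
  exact Finset.sum_comm

end PMF

/-! ### Independent coins -/

/-- The probability of the vector `st` of independent coins with biases `p i`. -/
def bernWeight {ι : Type*} [Fintype ι] (p : ι → ℝ) (st : ι → Bool) : ℝ :=
  ∏ i, if st i then p i else 1 - p i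

/-- The expectation of a function of independent coins with biases `p i`. -/
def bernMean {ι : Type*} [Fintype ι] [DecidableEq ι] (p : ι → ℝ) (f : (ι → Bool) → ℝ) : ℝ :=
  ∑ st, bernWeight p st * f st

section Bernoulli

variable {ι : Type*} [Fintype ι] [DecidableEq ι] (p : ι → ℝ)

theorem bernMean_split (i : ι) (f : (ι → Bool) → ℝ) :
    bernMean p f = ∑ s : {j // j ≠ i} → Bool, bernWeight (fun j : {j // j ≠ i} => p j) s *
      (p i * f ((Equiv.funSplitAt i Bool).symm (true, s)) +
        (1 - p i) * f ((Equiv.funSplitAt i Bool).symm (false, s))) := by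
  unfold bernMean
  have hw : ∀ b s, bernWeight p ((Equiv.funSplitAt i Bool).symm (b, s)) =
      (if b then p i else 1 - p i) * bernWeight (fun j : {j // j ≠ i} => p j) s := fun b s => by
    unfold bernWeight
    rw [Fintype.prod_eq_mul_prod_subtype_ne _ i]
    congr 1
    · simp
    · refine Finset.prod_congr rfl fun j _ => ?_
      simp [j.2]
  rw [← (Equiv.funSplitAt i Bool).symm.sum_comp, Fintype.sum_prod_type, Fintype.sum_bool,
    ← Finset.sum_add_distrib]
  refine Finset.sum_congr rfl fun s _ => ?_
  rw [hw, hw]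
  simp only [if_true, Bool.false_eq_true, if_false]
  ring

/-- Coin `i` is independent of whatever does not read it. This is the conditioning step behind both
`VertexProbe` and the offline decision trees. -/
theorem bernMean_ite (i : ι) (f g : (ι → Bool) → ℝ)
    (hf : ∀ st b, f (Function.update st i b) = f st)
    (hg : ∀ st b, g (Function.update st i b) = g st) :
    (bernMean p fun st => if st i then f st else g st) =
      p i * bernMean p f + (1 - p i) * bernMean p g := by
  have key : ∀ h : (ι → Bool) → ℝ, (∀ st b, h (Function.update st i b) = h st) → ∀ s,
      h ((Equiv.funSplitAt i Bool).symm (false, s)) =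
        h ((Equiv.funSplitAt i Bool).symm (true, s)) := fun h hh s => by
    rw [← hh ((Equiv.funSplitAt i Bool).symm (true, s)) false]
    congr 1
    ext j
    by_cases hj : j = i
    · subst hj; simp
    · simp [hj]
  rw [bernMean_split p i, bernMean_split p i f, bernMean_split p i g, Finset.mul_sum,
    Finset.mul_sum, ← Finset.sum_add_distrib]
  refine Finset.sum_congr rfl fun s _ => ?_
  rw [key f hf, ← key g hg]
  simp
  ring

theorem bernMean_const (c : ℝ) : (bernMean p fun _ => c) = c := by
  unfold bernMean bernWeight
  rw [← Finset.sum_mul, ← Fintype.prod_sum fun (i : ι) (b : Bool) => if b then p i else 1 - p i]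
  simp

theorem bernMean_add (f g : (ι → Bool) → ℝ) :
    (bernMean p fun st => f st + g st) = bernMean p f + bernMean p g := by
  simp only [bernMean, mul_add, Finset.sum_add_distrib]

theorem bernMean_sub (f g : (ι → Bool) → ℝ) :
    (bernMean p fun st => f st - g st) = bernMean p f - bernMean p g := by
  simp only [bernMean, mul_sub, Finset.sum_sub_distrib]

theorem bernMean_const_mul (c : ℝ) (f : (ι → Bool) → ℝ) :
    (bernMean p fun st => c * f st) = c * bernMean p f := by
  simp only [bernMean, Finset.mul_sum, mul_left_comm]

theorem bernMean_sum {κ : Type*} (s : Finset κ) (f : κ → (ι → Bool) → ℝ) :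
    (bernMean p fun st => ∑ k ∈ s, f k st) = ∑ k ∈ s, bernMean p (f k) := by
  simp only [bernMean, Finset.mul_sum]
  exact Finset.sum_comm

end Bernoulli

/-- Edges at different online vertices are disjoint coordinates, so the sum over all states factors
by distributivity. -/
theorem bernMean_prod_columns {U V : Type*} [Fintype U] [Fintype V] [DecidableEq U]
    [DecidableEq V] (p : U × V → ℝ) (f : V → (U → Bool) → ℝ) :
    (bernMean p fun st => ∏ v, f v fun u => st (u, v)) =
      ∏ v, bernMean (fun u => p (u, v)) (f v) := by
  unfold bernMean
  rw [Fintype.prod_sum]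
  let E : (V → U → Bool) ≃ (U × V → Bool) :=
    { toFun := fun s e => s e.2 e.1
      invFun := fun st v u => st (u, v)
      left_inv := fun _ => rfl
      right_inv := fun _ => rfl }
  rw [← E.sum_comp]
  refine Finset.sum_congr rfl fun s _ => ?_
  rw [Finset.prod_mul_distrib]
  congr 1
  unfold bernWeight
  rw [Fintype.prod_prod_type_right]
  rfl

/-! ### Hit probabilities and the polytope form of the configuration LP -/

namespace StochasticGraph

theorem biasedCoin_mean (r : ℝ) (h0 : 0 ≤ r) (h1 : r ≤ 1) (f : Bool → ℝ) :
    (biasedCoin r h0 h1).mean f = r * f true + (1 - r) * f false := by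
  simp [PMF.mean, biasedCoin, h0, h1]

theorem edgeStates_mean {U V : Type*} [Fintype U] [Fintype V] [DecidableEq U] [DecidableEq V]
    (G : StochasticGraph U V) (f : (U × V → Bool) → ℝ) :
    G.edgeStates.mean f = bernMean (fun e => G.p e.1 e.2) f := by
  unfold PMF.mean bernMean bernWeight
  refine Finset.sum_congr rfl fun st _ => ?_
  congr 1
  simp only [edgeStates, PMF.ofFintype_apply, ENNReal.toReal_prod]
  refine Finset.prod_congr rfl fun e _ => ?_
  have h0 := G.p_nonneg e.1 e.2
  have h1 := G.p_le_one e.1 e.2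
  cases h : st e <;> simp [biasedCoin, h0, h1]

/-- The probability that the edge `(u, v)` is the first active edge of the string `l` at `v`. -/
def hitProb {U V : Type*} [DecidableEq U] (G : StochasticGraph U V) (v : V) (l : List U) (u : U) :
    ℝ :=
  if u ∈ l then G.p u v * G.q v (before l u) else 0

theorem nil_mem {U V : Type*} (G : StochasticGraph U V) (v : V) : [] ∈ G.C v :=
  let ⟨l, hl⟩ := G.C_nonempty v
  G.mem_of_sublist v l hl [] (List.nil_sublist l)

section HitProb

variable {U V : Type*} [DecidableEq U] (G : StochasticGraph U V) (v : V)

theorem hitProb_nil : G.hitProb v [] = 0 := by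
  ext u
  simp [hitProb]

theorem hitProb_cons (a : U) (l : List U) (u : U) :
    G.hitProb v (a :: l) u = if a = u then G.p a v else (1 - G.p a v) * G.hitProb v l u := by
  by_cases h : a = u
  · subst h
    simp [hitProb, before, q]
  · by_cases hl : u ∈ l
    · simp [hitProb, before, q, h, hl]
      ring
    · simp [hitProb, h, hl, Ne.symm h]

theorem hitProb_nonneg (l : List U) (u : U) : 0 ≤ G.hitProb v l u := by
  have := G.p_nonneg u v
  unfold hitProb q
  split_ifs
  · refine mul_nonneg this (List.prod_nonneg ?_)
    intro x hx
    obtain ⟨a, -, rfl⟩ := List.mem_map.1 hx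
    exact sub_nonneg.2 (G.p_le_one a v)
  · rfl

theorem val_eq_sum_hitProb [Fintype U] {l : List U} (hl : l.Nodup) :
    G.val v l = ∑ u, G.w u v * G.hitProb v l u := by
  unfold val hitProb
  rw [← List.sum_toFinset _ hl]
  simp only [mul_ite, mul_zero]
  rw [← Finset.sum_filter]
  refine Finset.sum_congr (by ext; simp) fun u _ => by ring

theorem bernMean_find? [Fintype U] {l : List U} (hl : l.Nodup) (u : U) :
    (bernMean (fun u => G.p u v) fun c => if l.find? c = some u then 1 else 0) =
      G.hitProb v l u := by
  induction l with
  | nil => simp [hitProb, bernMean_const]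
  | cons a l ih =>
    obtain ⟨ha, hl'⟩ := List.nodup_cons.1 hl
    have : (fun c : U → Bool => if (a :: l).find? c = some u then (1 : ℝ) else 0) =
        fun c => if c a then (if a = u then 1 else 0) else
          (if l.find? c = some u then 1 else 0) := by
      ext c
      cases hc : c a <;> simp [hc]
    rw [this, bernMean_ite, ih hl', bernMean_const, hitProb_cons]
    · split_ifs with h
      · subst h
        simp [hitProb, ha]
      · simp
    · simp
    · intro c b
      -- The tail never reads coin `a`, because the string has distinct entries.
      have : l.find? (Function.update c a b) = l.find? c := by
        clear ih this hl hl'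
        induction l with
        | nil => rfl
        | cons x l ih =>
          have hx : x ≠ a := fun h => ha (by simp [h])
          simp only [List.find?_cons, Function.update_of_ne hx]
          rw [ih fun h => ha (by simp [h])]
      rw [this]

/-- Replace the probe of `u₀` by a private coin of the same bias: on success stop, as if `u₀` had
been active, otherwise skip `u₀`. All other hit probabilities are unchanged, and both strings are
substrings of `l`. -/
theorem hitProb_zero_coordinate (l : List U) (hl : l.Nodup) (u₀ : U) :
    (fun u => if u = u₀ then 0 else G.hitProb v l u) =
      G.p u₀ v • G.hitProb v (before l u₀) + (1 - G.p u₀ v) • G.hitProb v (l.erase u₀) := by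
  induction l with
  | nil => ext; simp [before, hitProb_nil]
  | cons a l ih =>
    obtain ⟨ha, hl⟩ := List.nodup_cons.1 hl
    ext u
    have := congrFun (ih hl) u
    simp only [Pi.add_apply, Pi.smul_apply, smul_eq_mul] at this ⊢
    by_cases h : a = u₀
    · subst h
      have e1 : before (a :: l) a = [] := by simp [before]
      rw [e1, hitProb_nil, List.erase_cons_head, hitProb_cons]
      by_cases hu : u = a
      · subst hu
        simp [hitProb, ha]
      · simp [hu, Ne.symm hu]
    · have e1 : before (a :: l) u₀ = a :: before l u₀ := by simp [before, h]
      rw [e1, List.erase_cons_tail (by simpa using h), hitProb_cons, hitProb_cons, hitProb_cons]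
      by_cases hu : u = u₀
      · subst hu
        simp only [if_true, if_neg h] at this ⊢
        linear_combination (1 - G.p a v) * this
      · simp only [if_neg hu] at this ⊢
        split_ifs
        · ring
        · linear_combination (1 - G.p a v) * this

/-- The vectors of probabilities of the edges at `v` to be returned by a random string of `C v`. -/
def hitHull : Set (U → ℝ) := convexHull ℝ (G.hitProb v '' G.C v)

theorem hitProb_mem_hitHull {l : List U} (hl : l ∈ G.C v) : G.hitProb v l ∈ G.hitHull v :=
  subset_convexHull ℝ _ ⟨l, hl, rfl⟩

/-- The vectors realized by a distribution on `C v` form a convex set containing the generators.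
This turns points of the polytope back into LP variables. -/
theorem exists_distribution_of_mem_hitHull {y : U → ℝ} (hy : y ∈ G.hitHull v) :
    ∃ x : List U → ℝ, (∀ l ∈ G.C v, 0 ≤ x l) ∧ ∑ l ∈ G.C v, x l = 1 ∧
      ∀ u, ∑ l ∈ G.C v, G.hitProb v l u * x l = y u := by
  suffices h : G.hitHull v ⊆ {y | ∃ x : List U → ℝ, (∀ l ∈ G.C v, 0 ≤ x l) ∧
      ∑ l ∈ G.C v, x l = 1 ∧ ∀ u, ∑ l ∈ G.C v, G.hitProb v l u * x l = y u} from h hy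
  refine convexHull_min ?_ ?_
  · rintro _ ⟨l, hl, rfl⟩
    refine ⟨fun l' => if l' = l then 1 else 0, fun l' _ => ?_, ?_, fun u => ?_⟩
    · dsimp only; split_ifs <;> simp
    · simpa using hl
    · simp [Finset.mem_coe.1 hl]
  · rintro y ⟨x, hx0, hx1, hx⟩ y' ⟨x', hx0', hx1', hx'⟩ a b ha hb hab
    refine ⟨fun l => a * x l + b * x' l, fun l hl => ?_, ?_, fun u => ?_⟩
    · have := hx0 l hl
      have := hx0' l hl
      positivity
    · rw [Finset.sum_add_distrib, ← Finset.mul_sum, ← Finset.mul_sum, hx1, hx1']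
      linarith
    · simp only [Pi.add_apply, Pi.smul_apply, smul_eq_mul, ← hx, ← hx', Finset.mul_sum,
        ← Finset.sum_add_distrib]
      exact Finset.sum_congr rfl fun l _ => by ring

theorem zero_coordinate_mem_hitHull {y : U → ℝ} (hy : y ∈ G.hitHull v) (u₀ : U) :
    (fun u => if u = u₀ then 0 else y u) ∈ G.hitHull v := by
  refine convexHull_min (t := {y | (fun u => if u = u₀ then 0 else y u) ∈ G.hitHull v}) ?_ ?_ hy
  · rintro _ ⟨l, hl, rfl⟩
    have hl : l ∈ G.C v := hl
    rw [Set.mem_ofPred_eq, hitProb_zero_coordinate G v l (G.nodup_of_mem v l hl)]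
    exact convex_convexHull ℝ _
      (G.hitProb_mem_hitHull v (G.mem_of_sublist v l hl _ (List.takeWhile_sublist _)))
      (G.hitProb_mem_hitHull v (G.mem_of_sublist v l hl _ List.erase_sublist))
      (G.p_nonneg _ _) (sub_nonneg.2 (G.p_le_one _ _)) (by ring)
  · intro y hy y' hy' a b ha hb hab
    have := convex_convexHull ℝ _ hy hy' ha hb hab
    rw [Set.mem_ofPred_eq]
    refine (congrArg (· ∈ G.hitHull v) (funext fun u => ?_)).mpr this
    simp only [Pi.add_apply, Pi.smul_apply, smul_eq_mul]
    split_ifs <;> simp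

end HitProb

namespace LPSolution

variable {U V : Type*} [DecidableEq U] [Fintype V] {G : StochasticGraph U V}

/-- The probability that `VertexProbe` returns the edge `(u, v)`. -/
def hit (s : G.LPSolution) (v : V) (u : U) : ℝ := ∑ l ∈ G.C v, G.hitProb v l u * s.x v l

theorem hit_nonneg (s : G.LPSolution) (v : V) (u : U) : 0 ≤ s.hit v u :=
  Finset.sum_nonneg fun l hl => mul_nonneg (G.hitProb_nonneg v l u) (s.nonneg v l hl)

theorem hit_mem_hitHull (s : G.LPSolution) (v : V) : s.hit v ∈ G.hitHull v := by
  have : s.hit v = ∑ l ∈ G.C v, s.x v l • G.hitProb v l := by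
    ext u
    simp [hit, Finset.sum_apply, mul_comm]
  rw [this]
  exact (convex_convexHull ℝ _).sum_mem (s.nonneg v) (s.sum_eq_one v)
    fun l hl => G.hitProb_mem_hitHull v hl

theorem sum_filter_eq_sum_hitProb {U V : Type*} [DecidableEq U] (G : StochasticGraph U V)
    (x : List U → ℝ) (v : V) (u : U) :
    ∑ l ∈ G.C v with u ∈ l, G.p u v * G.q v (before l u) * x l =
      ∑ l ∈ G.C v, G.hitProb v l u * x l := by
  rw [Finset.sum_filter]
  refine Finset.sum_congr rfl fun l _ => ?_
  unfold hitProb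
  split_ifs <;> simp

theorem sum_hit_le_one (s : G.LPSolution) (u : U) : ∑ v, s.hit v u ≤ 1 := by
  refine le_of_eq_of_le (Finset.sum_congr rfl fun v _ => ?_) (s.matching_le u)
  exact (sum_filter_eq_sum_hitProb G (s.x v) v u).symm

theorem hit_le_one (s : G.LPSolution) (v : V) (u : U) : s.hit v u ≤ 1 :=
  (Finset.single_le_sum (fun v _ => s.hit_nonneg v u) (Finset.mem_univ v)).trans
    (s.sum_hit_le_one u)

theorem sum_val_eq [Fintype U] (s : G.LPSolution) (v : V) :
    ∑ l ∈ G.C v, G.val v l * s.x v l = ∑ u, G.w u v * s.hit v u := by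
  simp only [hit, Finset.mul_sum]
  rw [Finset.sum_comm]
  refine Finset.sum_congr rfl fun l hl => ?_
  rw [val_eq_sum_hitProb G v (G.nodup_of_mem v l hl), Finset.sum_mul]
  exact Finset.sum_congr rfl fun u _ => by ring

theorem objective_eq [Fintype U] (s : G.LPSolution) :
    s.objective = ∑ v, ∑ u, G.w u v * s.hit v u :=
  Finset.sum_congr rfl fun v _ => s.sum_val_eq v

/-- Together with `hit_mem_hitHull` and `sum_hit_le_one`, this removes strings from the LP:
feasibility depends only on the vectors `y v`. -/
theorem exists_of_mem_hitHull (y : V → U → ℝ) (hy : ∀ v, y v ∈ G.hitHull v)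
    (hy1 : ∀ u, ∑ v, y v u ≤ 1) : ∃ s : G.LPSolution, ∀ v u, s.hit v u = y v u := by
  choose x hx0 hx1 hx using fun v => G.exists_distribution_of_mem_hitHull v (hy v)
  refine ⟨⟨x, fun u => ?_, hx1, hx0⟩, hx⟩
  refine le_of_eq_of_le (Finset.sum_congr rfl fun v _ => ?_) (hy1 u)
  rw [sum_filter_eq_sum_hitProb, hx]

/-- Zeroing the coordinate `(u, v)` keeps the solution feasible and lowers the objective by exactly
this product, so optimality forbids a negative value. -/
theorem IsOptimal.w_mul_hit_nonneg [Fintype U] [DecidableEq V] {s : G.LPSolution}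
    (hs : s.IsOptimal) (v : V) (u : U) : 0 ≤ G.w u v * s.hit v u := by
  let y : V → U → ℝ := Function.update s.hit v fun u' => if u' = u then 0 else s.hit v u'
  have hyle : ∀ v' u', y v' u' ≤ s.hit v' u' := fun v' u' => by
    by_cases h : v' = v
    · subst h
      simp only [y, Function.update_self]
      split_ifs
      · exact s.hit_nonneg v' u'
      · rfl
    · simp [y, h]
  obtain ⟨s', hs'⟩ := exists_of_mem_hitHull (G := G) y (fun v' => by
    by_cases h : v' = v
    · subst h
      simp only [y, Function.update_self]
      exact G.zero_coordinate_mem_hitHull v' (s.hit_mem_hitHull v') u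
    · simp only [y, Function.update_of_ne h]
      exact s.hit_mem_hitHull v')
    fun u' => (Finset.sum_le_sum fun v' _ => hyle v' u').trans (s.sum_hit_le_one u')
  have h := hs s'
  rw [objective_eq, objective_eq] at h
  have e : ∑ v', ∑ u', G.w u' v' * s'.hit v' u' =
      ∑ v', ∑ u', G.w u' v' * s.hit v' u' - G.w u v * s.hit v u := by
    rw [eq_sub_iff_add_eq, ← Finset.add_sum_erase _ _ (Finset.mem_univ v),
      ← Finset.add_sum_erase _ _ (Finset.mem_univ v)]
    have e1 : ∑ v' ∈ Finset.univ.erase v, ∑ u', G.w u' v' * s'.hit v' u' =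
        ∑ v' ∈ Finset.univ.erase v, ∑ u', G.w u' v' * s.hit v' u' :=
      Finset.sum_congr rfl fun v' hv' => Finset.sum_congr rfl fun u' _ => by
        rw [hs']; simp [y, Finset.ne_of_mem_erase hv']
    have e2 : ∑ u', G.w u' v * s'.hit v u' + G.w u v * s.hit v u =
        ∑ u', G.w u' v * s.hit v u' := by
      rw [← Finset.add_sum_erase _ _ (Finset.mem_univ u),
        ← Finset.add_sum_erase _ (fun u' => G.w u' v * s.hit v u') (Finset.mem_univ u)]
      have : ∑ u' ∈ Finset.univ.erase u, G.w u' v * s'.hit v u' =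
          ∑ u' ∈ Finset.univ.erase u, G.w u' v * s.hit v u' :=
        Finset.sum_congr rfl fun u' hu' => by
          rw [hs']; simp [y, Finset.ne_of_mem_erase hu']
      rw [this, hs']
      simp [y]
    rw [e1, ← e2]
    ring
  linarith

end LPSolution

/-! ### The LP as an upper bound on offline probing -/

/-- The probability that a probing algorithm accepts the edge `e`. -/
def acceptProb {U V : Type*} [DecidableEq U] [DecidableEq V] (G : StochasticGraph U V) :
    ProbingAlgorithm U V → U × V → ℝ
  | .halt, _ => 0
  | .coin r l m, e => r * G.acceptProb l e + (1 - r) * G.acceptProb m e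
  | .probe f accept a b, e =>
      G.p f.1 f.2 * ((if accept = true ∧ f = e then 1 else 0) + G.acceptProb a e) +
        (1 - G.p f.1 f.2) * G.acceptProb b e

section Offline

variable {U V : Type*} [DecidableEq U] [DecidableEq V] {G : StochasticGraph U V}

/-- A matched endpoint stays matched in every continuation, which blocks all edges at it. -/
theorem IsOffline.acceptProb_eq_zero {T : ProbingAlgorithm U V} {L : V → List U}
    {M : Finset (U × V)} (h : G.IsOffline T L M) {e f : U × V} (hf : f ∈ M)
    (hef : f.1 = e.1 ∨ f.2 = e.2) : G.acceptProb T e = 0 := by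
  induction T generalizing L M with
  | halt => rfl
  | coin r l m hl hm => simp [acceptProb, hl h.1 hf, hm h.2 hf]
  | probe g accept a b ha hb =>
    obtain ⟨-, h1, h2, h3⟩ := h
    have h4 : ¬ (accept = true ∧ g = e) := by
      rintro ⟨h, rfl⟩
      have := h1 h f hf
      tauto
    have h5 : f ∈ if accept = true then insert g M else M := by
      split_ifs
      · exact Finset.mem_insert_of_mem hf
      · exact hf
    rw [acceptProb, ha h2 h5, hb h3 hf, if_neg h4]
    simp

theorem IsOffline.sum_acceptProb_le_one [Fintype V] {T : ProbingAlgorithm U V} {L : V → List U}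
    {M : Finset (U × V)} (h : G.IsOffline T L M) (u : U) : ∑ v, G.acceptProb T (u, v) ≤ 1 := by
  induction T generalizing L M with
  | halt => simp [acceptProb]
  | coin r l m hl hm =>
    have h0 := r.2.1
    have h1 := sub_nonneg.2 r.2.2
    have := mul_le_mul_of_nonneg_left (hl h.1) h0
    have := mul_le_mul_of_nonneg_left (hm h.2) h1
    simp only [acceptProb, Finset.sum_add_distrib, ← Finset.mul_sum]
    linarith
  | probe g accept a b ha hb =>
    obtain ⟨-, -, h2, h3⟩ := h
    have h0 := G.p_nonneg g.1 g.2
    have h1 := sub_nonneg.2 (G.p_le_one g.1 g.2)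
    have hb' := mul_le_mul_of_nonneg_left (hb h3) h1
    have ha' : ∑ v, ((if accept = true ∧ g = (u, v) then 1 else 0) + G.acceptProb a (u, v)) ≤ 1 := by
      rw [Finset.sum_add_distrib]
      -- If `g` is accepted at `u`, the active branch accepts nothing more at `u`; otherwise the
      -- indicator vanishes throughout and induction applies.
      by_cases hg : accept = true ∧ g.1 = u
      · obtain ⟨rfl, rfl⟩ := hg
        rw [Finset.sum_eq_zero (f := fun v => G.acceptProb a (g.1, v)) fun v _ =>
          h2.acceptProb_eq_zero (f := g) (by simp) (Or.inl rfl)]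
        simp [Prod.ext_iff]
      · rw [Finset.sum_eq_zero (f := fun v => if accept = true ∧ g = (u, v) then (1 : ℝ) else 0)]
        · simpa using ha h2
        · intro v _
          rw [if_neg]
          rintro ⟨h, rfl⟩
          exact hg ⟨h, rfl⟩
    have := mul_le_mul_of_nonneg_left ha' h0
    simp only [acceptProb, Finset.sum_add_distrib, ← Finset.mul_sum] at this ⊢
    linarith

theorem convexHull_hitProb_mono {U V : Type*} [DecidableEq U] {G : StochasticGraph U V} {v : V} {L L' : List U}
    (h : ∀ l, L' ++ l ∈ G.C v → L ++ l ∈ G.C v) :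
    convexHull ℝ (G.hitProb v '' {l | L' ++ l ∈ G.C v}) ⊆
      convexHull ℝ (G.hitProb v '' {l | L ++ l ∈ G.C v}) :=
  convexHull_mono (Set.image_mono h)

/-- The set of legal continuations of `L v` is what makes the induction work: a probe away from `v`
is a convex combination, a rejecting probe at `v` can be omitted, and an accepting probe at `v` is
prepended to the strings of the inactive branch. -/
theorem IsOffline.acceptProb_mem_convexHull {T : ProbingAlgorithm U V} {L : V → List U}
    {M : Finset (U × V)} (h : G.IsOffline T L M) {v : V} (hL : L v ∈ G.C v) :
    (fun u => G.acceptProb T (u, v)) ∈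
      convexHull ℝ (G.hitProb v '' {l | L v ++ l ∈ G.C v}) := by
  induction T generalizing L M with
  | halt =>
    refine subset_convexHull ℝ _ ⟨[], by simpa using hL, ?_⟩
    rw [hitProb_nil]
    rfl
  | coin r l m hl hm =>
    exact convex_convexHull ℝ _ (hl h.1 hL) (hm h.2 hL) r.2.1 (sub_nonneg.2 r.2.2) (by ring)
  | probe g accept a b ha hb =>
    obtain ⟨h0, -, h2, h3⟩ := h
    have p0 := G.p_nonneg g.1 g.2
    have p1 := sub_nonneg.2 (G.p_le_one g.1 g.2)
    have ha := ha h2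
    have hb := hb h3
    by_cases hv : g.2 = v
    · subst hv
      simp only [Function.update_self] at ha hb
      replace ha := ha h0
      replace hb := hb h0
      -- Closure under substrings: a legal continuation stays legal when the edge just probed is
      -- deleted.
      have hsub := convexHull_hitProb_mono (G := G) (v := g.2) (L := L g.2) (L' := L g.2 ++ [g.1])
        fun l hl => G.mem_of_sublist _ _ hl _ (by simp)
      cases accept with
      | false =>
        have := convex_convexHull ℝ _ (hsub ha) (hsub hb) p0 p1 (by ring)
        simp only [acceptProb, Bool.false_eq_true, false_and, if_false, zero_add]
        exact this
      | true =>
        have hz : ∀ u, G.acceptProb a (u, g.2) = 0 := fun u =>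
          h2.acceptProb_eq_zero (f := g) (by simp) (Or.inr rfl)
        -- Prepending `g.1` acts on hit vectors by this affine map. It suffices to check it on
        -- strings, where the term `(1 - p) * y u` vanishes at `u = g.1` because entries are
        -- distinct.
        have key : ∀ y ∈ convexHull ℝ (G.hitProb g.2 '' {l | L g.2 ++ [g.1] ++ l ∈ G.C g.2}),
            (fun u => G.p g.1 g.2 * (if g.1 = u then 1 else 0) + (1 - G.p g.1 g.2) * y u) ∈
              convexHull ℝ (G.hitProb g.2 '' {l | L g.2 ++ l ∈ G.C g.2}) := by
          intro y hy
          refine convexHull_min (t := {y : U → ℝ | (fun u => G.p g.1 g.2 * (if g.1 = u then 1 else 0)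
            + (1 - G.p g.1 g.2) * y u) ∈
              convexHull ℝ (G.hitProb g.2 '' {l | L g.2 ++ l ∈ G.C g.2})}) ?_ ?_ hy
          · rintro _ ⟨l, hl, rfl⟩
            rw [Set.mem_ofPred_eq] at hl ⊢
            refine subset_convexHull ℝ _ ⟨g.1 :: l, by simpa using hl, ?_⟩
            ext u
            rw [hitProb_cons]
            split_ifs with hu
            · subst hu
              have hn := G.nodup_of_mem _ _ hl
              rw [List.append_assoc, List.nodup_append] at hn
              have : g.1 ∉ l := (List.nodup_cons.1 hn.2.1).1
              simp [hitProb, this]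
            · simp
          · intro y hy y' hy' c d hc hd hcd
            have := convex_convexHull ℝ _ hy hy' hc hd hcd
            rw [Set.mem_ofPred_eq]
            refine (congrArg (· ∈ convexHull ℝ (G.hitProb g.2 '' {l | L g.2 ++ l ∈ G.C g.2}))
              (funext fun u => ?_)).mpr this
            simp only [Pi.add_apply, Pi.smul_apply, smul_eq_mul]
            linear_combination (-G.p g.1 g.2 * (if g.1 = u then 1 else 0)) * hcd
        have := key _ hb
        simpa [acceptProb, hz, Prod.ext_iff] using this
    · simp only [Function.update_of_ne (Ne.symm hv)] at ha hb
      have := convex_convexHull ℝ _ (ha hL) (hb hL) p0 p1 (by ring)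
      simp only [acceptProb, Prod.ext_iff, hv, and_false, if_false, zero_add]
      exact this

/-- A probed edge is never probed again, so its state no longer influences the run. -/
theorem IsOffline.run_update {T : ProbingAlgorithm U V} {L : V → List U}
    {M : Finset (U × V)} (h : G.IsOffline T L M) {e : U × V} (he : e.1 ∈ L e.2)
    (st : U × V → Bool) (c : Bool) : T.run (Function.update st e c) M = T.run st M := by
  induction T generalizing L M with
  | halt => rfl
  | coin r l m hl hm =>
    simp only [ProbingAlgorithm.run, hl h.1 he, hm h.2 he]
  | probe g accept a b ha hb =>
    obtain ⟨h0, -, h2, h3⟩ := h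
    have hg : g ≠ e := by
      rintro rfl
      have hn := G.nodup_of_mem _ _ h0
      rw [List.nodup_append] at hn
      exact hn.2.2 _ he _ (List.mem_singleton_self _) rfl
    have he' : e.1 ∈ Function.update L g.2 (L g.2 ++ [g.1]) e.2 := by
      by_cases hv : e.2 = g.2
      · rw [hv, Function.update_self, ← hv]
        exact List.mem_append_left _ he
      · rwa [Function.update_of_ne hv]
    simp only [ProbingAlgorithm.run, ha h2 he', hb h3 he', Function.update_of_ne hg]

theorem weight_insert {M : Finset (U × V)} {e : U × V} (he : e ∉ M) :
    G.weight (insert e M) = G.w e.1 e.2 + G.weight M :=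
  Finset.sum_insert he

/-- Condition on the edge probed first: neither continuation reads it again, so `bernMean_ite`
reproduces the recursion that defines `acceptProb`. -/
theorem IsOffline.mean_weight_run [Fintype U] [Fintype V] {T : ProbingAlgorithm U V}
    {L : V → List U} {M : Finset (U × V)} (h : G.IsOffline T L M) :
    (bernMean (fun e => G.p e.1 e.2) fun st => (T.run st M).mean G.weight) =
      G.weight M + ∑ e, G.w e.1 e.2 * G.acceptProb T e := by
  induction T generalizing L M with
  | halt => simp [ProbingAlgorithm.run, PMF.mean_pure, bernMean_const, acceptProb]
  | coin r l m hl hm =>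
    simp only [ProbingAlgorithm.run, PMF.mean_bind, biasedCoin_mean, if_true, Bool.false_eq_true,
      if_false, bernMean_add, bernMean_const_mul, hl h.1, hm h.2, acceptProb, mul_add,
      Finset.sum_add_distrib, mul_left_comm (G.w _ _), ← Finset.mul_sum]
    ring
  | probe g accept a b ha hb =>
    obtain ⟨h0, h1, h2, h3⟩ := h
    have hg : g.1 ∈ Function.update L g.2 (L g.2 ++ [g.1]) g.2 := by simp
    have e1 : (fun st : U × V → Bool =>
        ((ProbingAlgorithm.probe g accept a b).run st M).mean G.weight) = fun st =>
          if st g then (a.run st (if accept then insert g M else M)).mean G.weight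
          else (b.run st M).mean G.weight := by
      ext st
      rw [ProbingAlgorithm.run]
      split_ifs <;> rfl
    rw [e1, bernMean_ite _ g, ha h2, hb h3]
    · have e2 : G.weight (if accept = true then insert g M else M) =
          G.weight M + ∑ e, G.w e.1 e.2 * (if accept = true ∧ g = e then 1 else 0) := by
        cases accept with
        | false => simp
        | true =>
          have : g ∉ M := fun hgM => (h1 rfl g hgM).1 rfl
          simp [weight_insert this, add_comm]
      rw [e2]
      simp only [acceptProb, mul_add, Finset.sum_add_distrib, mul_left_comm (G.w _ _),
        ← Finset.mul_sum]
      ring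
    · intro st c
      rw [h2.run_update hg]
    · intro st c
      rw [h3.run_update hg]

theorem exists_lpSolution_of_isOffline [Fintype U] [Fintype V] {T : ProbingAlgorithm U V}
    (h : G.IsOffline T (fun _ => []) ∅) : ∃ s : G.LPSolution,
      s.objective = G.expectedWeight (G.edgeStates.bind fun st => T.run st ∅) := by
  obtain ⟨s, hs⟩ := LPSolution.exists_of_mem_hitHull (G := G) (fun v u => G.acceptProb T (u, v))
    (fun v => by simpa [hitHull] using h.acceptProb_mem_convexHull (G.nil_mem v)) h.sum_acceptProb_le_one
  refine ⟨s, ?_⟩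
  change _ = PMF.mean _ G.weight
  rw [PMF.mean_bind, edgeStates_mean, h.mean_weight_run, s.objective_eq,
    Fintype.sum_prod_type_right]
  simp [hs, weight]

theorem OPT_le_of_isOptimal [Fintype U] [Fintype V] {s : G.LPSolution} (hs : s.IsOptimal) :
    G.OPT ≤ s.objective := by
  refine csSup_le ⟨_, .halt, trivial, rfl⟩ ?_
  rintro _ ⟨T, hT, rfl⟩
  obtain ⟨s', hs'⟩ := exists_lpSolution_of_isOffline hT
  exact hs' ▸ hs s'

theorem OPT_nonneg [Fintype U] [Fintype V] : 0 ≤ G.OPT := by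
  refine le_csSup G.bddAbove_OPT ⟨.halt, trivial, ?_⟩
  change _ = PMF.mean _ G.weight
  simp [ProbingAlgorithm.run, PMF.mean_pure, weight]

end Offline

/-! ### The online algorithm for a fixed arrival order -/

variable {U V : Type*} [Fintype V] [DecidableEq U] [DecidableEq V]

theorem onlineMatching_support (G : StochasticGraph U V)
    (sol : ∀ S : Finset V, (G.induce S).LPSolution) (σ : Fin (Fintype.card V) ≃ V)
    (st : U × V → Bool) (M : Finset (U × V)) (hM : M ∈ (G.onlineMatching sol σ st).support) :
    IsMatching M ∧ ∀ e ∈ M, st e = true := by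
  suffices h : ∀ t, ∀ M ∈ (G.matchingAfter sol σ st t).support,
      IsMatching M ∧ (∀ e ∈ M, st e = true) ∧ ∀ e ∈ M, (σ.symm e.2).val < t from
    ⟨(h _ M hM).1, (h _ M hM).2.1⟩
  intro t
  induction t with
  | zero =>
    intro M hM
    have : M = ∅ := by simpa [matchingAfter] using hM
    subst this
    simp [IsMatching]
  | succ t ih =>
    intro M hM
    rw [matchingAfter, PMF.mem_support_bind_iff] at hM
    obtain ⟨N, hN, hM⟩ := hM
    obtain ⟨h1, h2, h3⟩ := ih N hN
    have hN' : IsMatching N ∧ (∀ e ∈ N, st e = true) ∧ ∀ e ∈ N, (σ.symm e.2).val < t + 1 :=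
      ⟨h1, h2, fun e he => (h3 e he).trans (Nat.lt_succ_self t)⟩
    split_ifs at hM with ht
    · unfold step at hM
      split_ifs at hM with hs
      · rw [PMF.mem_support_pure_iff] at hM
        exact hM ▸ hN'
      · rw [PMF.mem_support_map_iff] at hM
        obtain ⟨o, ho, hM⟩ := hM
        unfold LPSolution.vertexProbe at ho
        rw [PMF.mem_support_map_iff] at ho
        obtain ⟨l, -, ho⟩ := ho
        cases o with
        | none => exact hM ▸ hN'
        | some u =>
          have hu : st (u, σ ⟨t, ht⟩) = true :=
            List.find?_some (p := fun u => st (u, σ ⟨t, ht⟩)) ho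
          dsimp only at hM
          split_ifs at hM with hf
          · subst hM
            -- The third clause of the induction serves this purpose: matched online vertices
            -- arrived strictly earlier, so the current one is unmatched.
            have hne : ∀ e ∈ N, e.2 ≠ σ ⟨t, ht⟩ := fun e he h => by
              have := h3 e he
              simp [h] at this
            refine ⟨?_, ?_, ?_⟩
            · intro e he f hf' hef
              rcases Finset.mem_insert.1 he with rfl | he <;>
                rcases Finset.mem_insert.1 hf' with rfl | hf'
              · rfl
              · exact absurd hef (not_or.2 ⟨(hf f hf').symm, (hne f hf').symm⟩)
              · exact absurd hef (not_or.2 ⟨hf e he, hne e he⟩)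
              · exact h1 e he f hf' hef
            · intro e he
              rcases Finset.mem_insert.1 he with rfl | he
              · exact hu
              · exact h2 e he
            · intro e he
              rcases Finset.mem_insert.1 he with rfl | he
              · simp
              · exact (h3 e he).trans (Nat.lt_succ_self t)
          · exact hM ▸ hN'
    · rw [PMF.mem_support_pure_iff] at hM
      exact hM ▸ hN'

/-- The conditional probability, given the states `c` of the edges at the arrival number `i + 1`,
that the online algorithm tries to match this arrival with `u`. -/
noncomputable def proposalProb (G : StochasticGraph U V)
    (sol : ∀ S : Finset V, (G.induce S).LPSolution) (σ : Fin (Fintype.card V) ≃ V)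
    (i : Fin (Fintype.card V)) (c : U → Bool) (u : U) : ℝ :=
  if i.val + 1 < ⌊(Fintype.card V : ℝ) / Real.exp 1⌋₊ then 0
  else ∑ l ∈ G.C (σ i), (sol (arrived σ i)).x ⟨σ i, mem_arrived σ i⟩ l *
    if l.find? c = some u then 1 else 0

/-- The probability that the online algorithm tries to match the arrival number `i + 1`
with `u`. -/
noncomputable def meanProposalProb (G : StochasticGraph U V)
    (sol : ∀ S : Finset V, (G.induce S).LPSolution) (σ : Fin (Fintype.card V) ≃ V)
    (i : Fin (Fintype.card V)) (u : U) : ℝ :=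
  if i.val + 1 < ⌊(Fintype.card V : ℝ) / Real.exp 1⌋₊ then 0
  else (sol (arrived σ i)).hit ⟨σ i, mem_arrived σ i⟩ u

/-- The indicator of `u` being unmatched. -/
def free {U V : Type*} [DecidableEq U] (u : U) (M : Finset (U × V)) : ℝ := if ∀ f ∈ M, f.1 ≠ u then 1 else 0

theorem free_insert {U V : Type*} [DecidableEq U] [DecidableEq V] (u u' : U) (v : V) (M : Finset (U × V)) :
    free u (insert (u', v) M) = if u' = u then 0 else free u M := by
  by_cases h : u' = u
  · simp [free, h]
  · have : (∀ f ∈ insert (u', v) M, f.1 ≠ u) ↔ ∀ f ∈ M, f.1 ≠ u := by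
      simp only [Finset.forall_mem_insert]
      exact and_iff_right h
    simp only [free, if_neg h, this]

variable [Fintype U] (G : StochasticGraph U V)
  (sol : ∀ S : Finset V, (G.induce S).LPSolution) (σ : Fin (Fintype.card V) ≃ V)

theorem bernMean_proposalProb (i : Fin (Fintype.card V)) (u : U) :
    (bernMean (fun u => G.p u (σ i)) fun c => G.proposalProb sol σ i c u) =
      G.meanProposalProb sol σ i u := by
  unfold proposalProb meanProposalProb
  split_ifs
  · exact bernMean_const _ _
  · rw [bernMean_sum]
    refine Finset.sum_congr rfl fun l hl => ?_
    rw [bernMean_const_mul, bernMean_find? G (σ i) (G.nodup_of_mem _ l hl), mul_comm]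
    rfl

/-- At most one proposal is made, so the expected change of `F` is a sum over its possible targets.
It is used with `F` the weight and with `F` the indicator of a free vertex. -/
theorem mean_step (st : U × V → Bool) (i : Fin (Fintype.card V)) (M : Finset (U × V))
    (F : Finset (U × V) → ℝ) :
    (G.step sol σ st i M).mean F =
      F M + ∑ u, G.proposalProb sol σ i (fun u => st (u, σ i)) u *
        (free u M * (F (insert (u, σ i) M) - F M)) := by
  unfold step proposalProb
  split_ifs with h
  · simp [PMF.mean_pure]
  · set s := sol (arrived σ i)
    set v : {x // x ∈ arrived σ i} := ⟨σ i, mem_arrived σ i⟩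
    set c : U → Bool := fun u => st (u, σ i)
    rw [PMF.mean_map]
    unfold LPSolution.vertexProbe
    rw [PMF.mean_map]
    refine Eq.trans (congrArg (f := (s.draw v).mean) (a₂ := fun l => F M + ∑ u,
      (if l.1.find? c = some u then 1 else 0) * (free u M * (F (insert (u, σ i) M) - F M)))
      (funext fun l => ?_)) ?_
    · simp only [Function.comp_apply]
      cases l.1.find? c with
      | none => simp
      | some u =>
        simp only [Option.some.injEq, ite_mul, one_mul, zero_mul, Finset.sum_ite_eq,
          Finset.mem_univ, if_true, free]
        split_ifs <;> simp
    rw [PMF.mean_add, PMF.mean_const, PMF.mean_sum]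
    simp only [PMF.mean_mul_const]
    congr 1
    refine Finset.sum_congr rfl fun u _ => ?_
    congr 1
    unfold PMF.mean
    rw [← Finset.sum_coe_sort (G.C (σ i)) fun l => s.x v l * if l.find? c = some u then 1 else 0]
    refine Finset.sum_congr rfl fun l _ => ?_
    congr 1
    simp only [LPSolution.draw, PMF.ofFintype_apply]
    exact ENNReal.toReal_ofReal (s.nonneg v l.1 l.2)

theorem filter_val_lt_succ {n t : ℕ} (h : t < n) :
    Finset.univ.filter (fun j : Fin n => j.val < t + 1) =
      insert ⟨t, h⟩ (Finset.univ.filter fun j : Fin n => j.val < t) := by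
  ext j
  simp [Fin.ext_iff]
  omega

/-- Only a proposal to `u` can change the status of `u`, and with order and states fixed the draws
are fresh, so each arrival contributes one factor. -/
theorem mean_free_matchingAfter (st : U × V → Bool) (u : U) (t : ℕ)
    (ht : t ≤ Fintype.card V) :
    (G.matchingAfter sol σ st t).mean (free u) =
      ∏ j : Fin (Fintype.card V) with j.val < t,
        (1 - G.proposalProb sol σ j (fun u => st (u, σ j)) u) := by
  induction t with
  | zero => simp [matchingAfter, PMF.mean_pure, free]
  | succ t ih =>
    rw [filter_val_lt_succ ht, Finset.prod_insert (by simp), ← ih (Nat.le_of_succ_le ht),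
      matchingAfter, PMF.mean_bind, ← PMF.mean_const_mul]
    congr 1
    ext M
    rw [dif_pos (Nat.lt_of_succ_le ht), mean_step, Finset.sum_eq_single u]
    · rw [free_insert, if_pos rfl]
      have : free u M * free u M = free u M := by unfold free; split_ifs <;> simp
      linear_combination (-G.proposalProb sol σ ⟨t, ht⟩ (fun u => st (u, σ ⟨t, ht⟩)) u) * this
    · intro u' _ hu'
      rw [free_insert, if_neg hu']
      simp
    · simp

theorem mean_weight_matchingAfter (st : U × V → Bool) (t : ℕ) (ht : t ≤ Fintype.card V) :
    (G.matchingAfter sol σ st t).mean G.weight =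
      ∑ i : Fin (Fintype.card V) with i.val < t, ∑ u, G.w u (σ i) *
        (G.proposalProb sol σ i (fun u => st (u, σ i)) u *
          ∏ j : Fin (Fintype.card V) with j.val < i.val,
            (1 - G.proposalProb sol σ j (fun u => st (u, σ j)) u)) := by
  induction t with
  | zero => simp [matchingAfter, PMF.mean_pure, weight]
  | succ t ih =>
    rw [filter_val_lt_succ ht, Finset.sum_insert (by simp), ← ih (Nat.le_of_succ_le ht),
      matchingAfter, PMF.mean_bind]
    have e : (fun M => (if h : t < Fintype.card V then G.step sol σ st ⟨t, h⟩ M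
        else PMF.pure M).mean G.weight) = fun M => G.weight M + ∑ u, G.w u (σ ⟨t, ht⟩) *
          (G.proposalProb sol σ ⟨t, ht⟩ (fun u => st (u, σ ⟨t, ht⟩)) u * free u M) := by
      ext M
      rw [dif_pos (Nat.lt_of_succ_le ht), mean_step]
      congr 1
      refine Finset.sum_congr rfl fun u _ => ?_
      by_cases hf : ∀ f ∈ M, f.1 ≠ u
      · rw [weight_insert fun h => hf _ h rfl]
        ring
      · simp only [free, if_neg hf]
        ring
    rw [e, PMF.mean_add, PMF.mean_sum, add_comm]
    congr 1
    refine Finset.sum_congr rfl fun u _ => ?_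
    rw [PMF.mean_const_mul, PMF.mean_const_mul,
      mean_free_matchingAfter G sol σ st u t (Nat.le_of_succ_le ht)]

theorem prod_ite_lt {n : ℕ} (i : Fin n) (a : ℝ) (b : Fin n → ℝ) :
    ∏ j, (if j = i then a else if j.val < i.val then b j else 1) =
      a * ∏ j : Fin n with j.val < i.val, b j := by
  rw [← Finset.mul_prod_erase _ _ (Finset.mem_univ i), if_pos rfl, Finset.prod_filter]
  congr 1
  rw [← Finset.mul_prod_erase Finset.univ (fun j => if j.val < i.val then b j else 1)
    (Finset.mem_univ i), if_neg (lt_irrefl _), one_mul]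
  exact Finset.prod_congr rfl fun j hj => if_neg (Finset.ne_of_mem_erase hj)

/-- Each factor reads only the edges at its own arrival, so averaging over the edge states acts
factor by factor. -/
theorem bernMean_proposal_mul_prod (i : Fin (Fintype.card V)) (u : U) :
    (bernMean (fun e => G.p e.1 e.2) fun st =>
      G.proposalProb sol σ i (fun u => st (u, σ i)) u *
        ∏ j : Fin (Fintype.card V) with j.val < i.val,
          (1 - G.proposalProb sol σ j (fun u => st (u, σ j)) u)) =
      G.meanProposalProb sol σ i u *
        ∏ j : Fin (Fintype.card V) with j.val < i.val, (1 - G.meanProposalProb sol σ j u) := by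
  -- Arrivals after `i` receive the constant factor 1, so the expression becomes a product over all
  -- columns.
  let g : Fin (Fintype.card V) → (U → Bool) → ℝ := fun j c =>
    if j = i then G.proposalProb sol σ i c u
    else if j.val < i.val then 1 - G.proposalProb sol σ j c u else 1
  have h1 := bernMean_prod_columns (fun e : U × V => G.p e.1 e.2) fun v => g (σ.symm v)
  have h2 : ∀ st : U × V → Bool, ∏ v, g (σ.symm v) (fun u => st (u, v)) =
      G.proposalProb sol σ i (fun u => st (u, σ i)) u *
        ∏ j : Fin (Fintype.card V) with j.val < i.val,
          (1 - G.proposalProb sol σ j (fun u => st (u, σ j)) u) := fun st => by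
    rw [← prod_ite_lt, ← σ.prod_comp]
    refine Finset.prod_congr rfl fun j _ => ?_
    simp only [Equiv.symm_apply_apply, g]
    split_ifs with h
    · rw [h]
    · rfl
    · rfl
  simp only [h2] at h1
  rw [h1, ← prod_ite_lt, ← σ.prod_comp]
  refine Finset.prod_congr rfl fun j _ => ?_
  simp only [Equiv.symm_apply_apply, g]
  split_ifs with h
  · rw [h]
    exact bernMean_proposalProb G sol σ i u
  · rw [bernMean_sub, bernMean_const, bernMean_proposalProb]
  · exact bernMean_const _ _

theorem expectedWeight_onlineMatchingROM :
    G.expectedWeight (G.onlineMatchingROM sol) = (randomOrder V).mean fun σ =>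
      ∑ i, ∑ u, G.w u (σ i) * (G.meanProposalProb sol σ i u *
        ∏ j : Fin (Fintype.card V) with j.val < i.val, (1 - G.meanProposalProb sol σ j u)) := by
  change PMF.mean _ G.weight = _
  unfold onlineMatchingROM onlineMatching
  rw [PMF.mean_bind]
  congr 1
  ext σ
  rw [PMF.mean_bind, edgeStates_mean]
  simp only [mean_weight_matchingAfter G sol σ _ _ le_rfl, Fin.is_lt, Finset.filter_true,
    bernMean_sum, bernMean_const_mul, bernMean_proposal_mul_prod]

/-! ### The harmonic sum estimate -/

theorem log_div_le_sum_Ico_one_div {a n : ℕ} (ha : 1 ≤ a) (han : a ≤ n) :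
    Real.log ((n : ℝ) / a) ≤ ∑ i ∈ Finset.Ico a n, 1 / (i : ℝ) := by
  have ha' : (0 : ℝ) < a := by exact_mod_cast ha
  induction n, han using Nat.le_induction with
  | base => simp [ha'.ne']
  | succ n hn ih =>
    have hn' : (0 : ℝ) < n := lt_of_lt_of_le ha' (by exact_mod_cast hn)
    have h1 : (((n + 1 : ℕ) : ℝ)) / a = (n / a) * ((n + 1) / n) := by
      push_cast
      field_simp
    have h2 : Real.log (((n : ℝ) + 1) / n) ≤ 1 / n := by
      have := Real.log_le_sub_one_of_pos (x := ((n : ℝ) + 1) / n) (by positivity)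
      refine this.trans (le_of_eq ?_)
      field_simp
      ring
    rw [Finset.sum_Ico_succ_top hn, h1, Real.log_mul (by positivity) (by positivity)]
    linarith

/-- The hypotheses say that `a + 1 = ⌊n/e⌋`, so `n - e * a` lies between `e` and `2 * e`. Large `n`
follows from the logarithm, small `n` from evaluating the sums. -/
theorem div_exp_sub_one_le_mul_sum_Ico {a n : ℕ} (ha : 1 ≤ a)
    (h1 : (a + 1 : ℝ) * Real.exp 1 ≤ n) (h2 : (n : ℝ) < (a + 2) * Real.exp 1) :
    n / Real.exp 1 - 1 ≤ a * ∑ i ∈ Finset.Ico a n, 1 / (i : ℝ) := by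
  have he1 := Real.exp_one_gt_d9
  have he2 := Real.exp_one_lt_d9
  have ha' : (1 : ℝ) ≤ a := by exact_mod_cast ha
  set e := Real.exp 1
  have he : 0 < e := by linarith
  have hn' : (0 : ℝ) < n := by nlinarith
  have han : a ≤ n := by
    have : (a : ℝ) ≤ n := by nlinarith
    exact_mod_cast this
  -- The logarithmic estimate needs `4 * e ^ 2 ≤ e * n`, that is `n ≥ 4 * e ≈ 10.87`.
  rcases le_or_gt 11 n with hn | hn
  · have hn11 : (11 : ℝ) ≤ n := by exact_mod_cast hn
    -- Write `log (n/a) = 1 + log (n/(e*a))` and apply `1 - 1/x ≤ log x`, which is sharp near `x =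
    -- 1`.
    have hlog : 2 - e * a / n ≤ Real.log ((n : ℝ) / a) := by
      have h3 := Real.one_sub_inv_le_log_of_pos (x := (n : ℝ) / a / e) (by positivity)
      rw [Real.log_div (by positivity) he.ne', Real.log_exp] at h3
      have : ((n : ℝ) / a / e)⁻¹ = e * a / n := by field_simp
      linarith
    have h4 := mul_le_mul_of_nonneg_left (hlog.trans (log_div_le_sum_Ico_one_div ha han))
      (by linarith : (0 : ℝ) ≤ a)
    refine le_trans ?_ h4
    have h5 : (n - e * a) ^ 2 ≤ (2 * e) ^ 2 := by
      refine pow_le_pow_left₀ ?_ ?_ 2 <;> nlinarith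
    have h6 : a * (2 - e * a / n) - (n / e - 1) = (e * n - (n - e * a) ^ 2) / (e * n) := by
      field_simp
      ring
    have h7 : 0 ≤ (e * n - (n - e * a) ^ 2) / (e * n) := by
      refine div_nonneg ?_ (by positivity)
      nlinarith
    linarith
  -- Replacing `e` by 2.7 makes the finitely many remaining inequalities rational.
  · have h3 : (n : ℝ) / e ≤ n / 2.7 := by gcongr; linarith
    have ha3 : a < 3 := by
      have : (n : ℝ) ≤ 10 := by exact_mod_cast Nat.lt_succ_iff.1 hn
      have : (a : ℝ) < 3 := by nlinarith
      exact_mod_cast this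
    refine (sub_le_sub_right h3 1).trans ?_
    interval_cases a
    · have : 5 < n := by
        norm_num at h1
        have : (5 : ℝ) < n := by linarith
        exact_mod_cast this
      interval_cases n <;> norm_num [Finset.sum_Ico_succ_top] at h2 ⊢
    · have : 8 < n := by
        norm_num at h1
        have : (8 : ℝ) < n := by linarith
        exact_mod_cast this
      interval_cases n <;> norm_num [Finset.sum_Ico_succ_top] at h2 ⊢

end StochasticGraph

/-! ### Exchangeability of the random arrival order -/

namespace PMF

theorem mean_mono {α : Type*} [Fintype α] (μ : PMF α) {f g : α → ℝ} (h : ∀ a, f a ≤ g a) :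
    μ.mean f ≤ μ.mean g :=
  Finset.sum_le_sum fun a _ => mul_le_mul_of_nonneg_left (h a) ENNReal.toReal_nonneg

theorem mean_nonneg {α : Type*} [Fintype α] (μ : PMF α) {f : α → ℝ} (h : ∀ a, 0 ≤ f a) :
    0 ≤ μ.mean f :=
  Finset.sum_nonneg fun a _ => mul_nonneg ENNReal.toReal_nonneg (h a)

end PMF

namespace StochasticGraph

section RandomOrder

variable {V : Type*} [Fintype V] [DecidableEq V]

theorem randomOrder_mean_comp (π : Equiv.Perm (Fin (Fintype.card V)))
    (f : (Fin (Fintype.card V) ≃ V) → ℝ) :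
    ((randomOrder V).mean fun σ => f (π.trans σ)) = (randomOrder V).mean f := by
  have hc : ∀ σ τ, randomOrder V σ = randomOrder V τ := fun σ τ => by
    simp [randomOrder, PMF.uniformOfFintype_apply]
  unfold PMF.mean
  let E : (Fin (Fintype.card V) ≃ V) ≃ (Fin (Fintype.card V) ≃ V) :=
    Equiv.equivCongr π.symm (Equiv.refl V)
  rw [← E.sum_comp fun σ => (randomOrder V σ).toReal * f σ]
  refine Finset.sum_congr rfl fun σ _ => ?_
  rw [hc σ (E σ)]
  rfl

/-- The swap permutes the positions up to `k` among themselves. -/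
theorem arrived_swap_trans (σ : Fin (Fintype.card V) ≃ V) {i j k : Fin (Fintype.card V)}
    (hj : j ≤ i) (hk : i ≤ k) : arrived ((Equiv.swap j i).trans σ) k = arrived σ k := by
  have h : ∀ x, Equiv.swap j i x ≤ k ↔ x ≤ k := fun x => by
    rw [Equiv.swap_apply_def]
    split_ifs with h1 h2
    · subst h1; exact ⟨fun _ => hj.trans hk, fun _ => hk⟩
    · subst h2; exact ⟨fun _ => hk, fun _ => hj.trans hk⟩
    · rfl
  ext v
  simp only [arrived, Finset.mem_image, Finset.mem_filter, Finset.mem_univ, true_and]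
  constructor
  · rintro ⟨x, hx, rfl⟩
    exact ⟨_, (h x).2 hx, rfl⟩
  · rintro ⟨x, hx, rfl⟩
    exact ⟨Equiv.swap j i x, (h x).2 hx, by simp⟩

theorem card_arrived (σ : Fin (Fintype.card V) ≃ V) (i : Fin (Fintype.card V)) :
    (arrived σ i).card = i.val + 1 := by
  rw [arrived, Finset.card_image_of_injective _ σ.injective]
  rw [← Fin.card_Iic i]
  congr 1
  ext j
  simp

/-- Swapping positions `j` and `i` preserves the law, `Z` and the arrived set, so each of the `i +
1` vertices in that set is equally likely to be arrival `i`, even under the weighting by `Z`. -/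
theorem randomOrder_mean_mul_arrival (i : Fin (Fintype.card V))
    (Z : (Fin (Fintype.card V) ≃ V) → ℝ)
    (hZ : ∀ σ, ∀ j ≤ i, Z ((Equiv.swap j i).trans σ) = Z σ) (g : Finset V → V → ℝ) :
    ((i.val + 1 : ℕ) : ℝ) * ((randomOrder V).mean fun σ => Z σ * g (arrived σ i) (σ i)) =
      (randomOrder V).mean fun σ => Z σ * ∑ v ∈ arrived σ i, g (arrived σ i) v := by
  have h1 : ∀ σ : Fin (Fintype.card V) ≃ V, Z σ * ∑ v ∈ arrived σ i, g (arrived σ i) v =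
      ∑ j ∈ Finset.univ.filter (· ≤ i), Z σ * g (arrived σ i) (σ j) := fun σ => by
    rw [← Finset.mul_sum]
    congr 1
    nth_rewrite 1 [arrived]
    rw [Finset.sum_image fun _ _ _ _ h => σ.injective h]
  simp only [h1, PMF.mean_sum]
  rw [Finset.sum_congr rfl (g := fun _ => (randomOrder V).mean fun σ =>
    Z σ * g (arrived σ i) (σ i)), Finset.sum_const, nsmul_eq_mul]
  · congr 2
    rw [← Fin.card_Iic i]
    congr 1
    ext j
    simp
  · intro j hj
    have hj : j ≤ i := (Finset.mem_filter.1 hj).2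
    rw [← randomOrder_mean_comp (Equiv.swap j i)]
    congr 1
    ext σ
    rw [hZ σ j hj, arrived_swap_trans σ hj le_rfl, Equiv.trans_apply, Equiv.swap_apply_left]

theorem randomOrder_mean_apply (i : Fin (Fintype.card V)) (c : V → ℝ) :
    (Fintype.card V : ℝ) * ((randomOrder V).mean fun σ => c (σ i)) = ∑ v, c v := by
  have h : ∀ j, ((randomOrder V).mean fun σ => c (σ j)) =
      (randomOrder V).mean fun σ => c (σ i) := fun j => by
    rw [← randomOrder_mean_comp (Equiv.swap j i)]
    simp
  calc _ = ∑ j, (randomOrder V).mean fun σ => c (σ j) := by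
        rw [Finset.sum_congr rfl fun j _ => h j]
        simp
    _ = (randomOrder V).mean fun _ => ∑ v, c v := by
        rw [← PMF.mean_sum]
        congr 1
        ext σ
        exact σ.sum_comp c
    _ = _ := PMF.mean_const _ _

/-- If every arrival `j` with `k ≤ j < i` conflicts with a probability that sums up to at most one
over the arrived vertices, then a nonnegative function of the arrival `i` loses at most the factor
`k / i`. -/
theorem randomOrder_mean_mul_prod_ge (i : Fin (Fintype.card V)) (y h : Finset V → V → ℝ)
    (hy : ∀ S, ∀ v ∈ S, 0 ≤ y S v) (h1 : ∀ S, ∀ v ∈ S, h S v ≤ 1)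
    (hs : ∀ S, ∑ v ∈ S, h S v ≤ 1) (k : ℕ) (hk : k ≤ i.val) :
    (k : ℝ) * ((randomOrder V).mean fun σ => y (arrived σ i) (σ i)) ≤
      (i.val : ℝ) * (randomOrder V).mean fun σ => y (arrived σ i) (σ i) *
        ∏ j : Fin (Fintype.card V) with k ≤ j.val ∧ j.val < i.val,
          (1 - h (arrived σ j) (σ j)) := by
  induction hk using Nat.decreasingInduction with
  | self =>
    refine le_of_eq ?_
    congr 2
    ext σ
    rw [Finset.filter_false_of_mem fun j _ => by omega]
    simp
  | of_succ k hk ih =>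
    let K : Fin (Fintype.card V) := ⟨k, hk.trans i.2⟩
    let Z : (Fin (Fintype.card V) ≃ V) → ℝ := fun σ => y (arrived σ i) (σ i) *
      ∏ j : Fin (Fintype.card V) with k + 1 ≤ j.val ∧ j.val < i.val, (1 - h (arrived σ j) (σ j))
    have hZ0 : ∀ σ, 0 ≤ Z σ := fun σ => mul_nonneg (hy _ _ (mem_arrived σ i))
      (Finset.prod_nonneg fun j _ => sub_nonneg.2 (h1 _ _ (mem_arrived σ j)))
    -- `Z` involves only arrivals at positions after `k` and the arrived sets there, none of which
    -- depends on the order of the first `k + 1` vertices.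
    have hZ : ∀ σ, ∀ j ≤ K, Z ((Equiv.swap j K).trans σ) = Z σ := fun σ j hj => by
      have hjk : j.val ≤ k := hj
      have hap : ∀ x : Fin (Fintype.card V), k < x.val → Equiv.swap j K x = x := fun x hx =>
        Equiv.swap_apply_of_ne_of_ne (Fin.ne_of_val_ne (by omega)) (Fin.ne_of_val_ne hx.ne')
      simp only [Z]
      congr 1
      · rw [arrived_swap_trans σ hj (Fin.le_def.2 hk.le), Equiv.trans_apply, hap i hk]
      · refine Finset.prod_congr rfl fun x hx => ?_
        have hx : k < x.val := (Finset.mem_filter.1 hx).2.1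
        rw [arrived_swap_trans σ hj (Fin.le_def.2 hx.le), Equiv.trans_apply, hap x hx]
    have e : ∀ σ : Fin (Fintype.card V) ≃ V, y (arrived σ i) (σ i) *
        ∏ j : Fin (Fintype.card V) with k ≤ j.val ∧ j.val < i.val, (1 - h (arrived σ j) (σ j)) =
        Z σ * (1 - h (arrived σ K) (σ K)) := fun σ => by
      have : Finset.univ.filter (fun j : Fin (Fintype.card V) => k ≤ j.val ∧ j.val < i.val) =
          insert K (Finset.univ.filter fun j : Fin (Fintype.card V) =>
            k + 1 ≤ j.val ∧ j.val < i.val) := by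
        ext j
        simp only [Finset.mem_filter, Finset.mem_univ, true_and, Finset.mem_insert, Fin.ext_iff, K]
        omega
      rw [this, Finset.prod_insert (by simp [K])]
      simp only [Z]
      ring
    simp only [e]
    have h2 := randomOrder_mean_mul_arrival K Z hZ fun S v => 1 - h S v
    -- Over `k + 1` vertices the conflicts sum to at most 1, so the sum of `1 - h` is at least `k`.
    -- With `h2`, the new factor costs at most `k / (k + 1)`.
    have h3 : (k : ℝ) * (randomOrder V).mean Z ≤
        (randomOrder V).mean fun σ => Z σ * ∑ v ∈ arrived σ K, (1 - h (arrived σ K) v) := by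
      rw [← PMF.mean_const_mul]
      refine PMF.mean_mono _ fun σ => ?_
      rw [mul_comm]
      refine mul_le_mul_of_nonneg_left ?_ (hZ0 σ)
      rw [Finset.sum_sub_distrib, Finset.sum_const, card_arrived, nsmul_one]
      have := hs (arrived σ K)
      push_cast
      linarith
    rw [← h2] at h3
    have h4 := mul_le_mul_of_nonneg_left h3 (Nat.cast_nonneg (α := ℝ) i.val)
    have h5 := mul_le_mul_of_nonneg_left ih (Nat.cast_nonneg (α := ℝ) k)
    have h6 : (0 : ℝ) < ((k + 1 : ℕ) : ℝ) := by positivity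
    refine le_of_mul_le_mul_left ?_ h6
    simp only [K] at h4 ⊢
    simp only [Z] at h4 h5 ⊢
    nlinarith

end RandomOrder

/-! ### The competitive ratio -/

section Online

variable {U V : Type*} [DecidableEq U] [DecidableEq V]
  {G : StochasticGraph U V} {sol : ∀ S : Finset V, (G.induce S).LPSolution}

/-- The probability that `VertexProbe` on `v`, run with the solution for `S`, returns `(u, v)`. -/
noncomputable def solHit (sol : ∀ S : Finset V, (G.induce S).LPSolution) (S : Finset V) (v : V)
    (u : U) : ℝ :=
  if h : v ∈ S then (sol S).hit ⟨v, h⟩ u else 0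

theorem solHit_le_one (S : Finset V) (v : V) (u : U) : solHit sol S v u ≤ 1 := by
  unfold solHit
  split_ifs
  · exact (sol S).hit_le_one _ _
  · exact zero_le_one

theorem sum_solHit_le_one (S : Finset V) (u : U) : ∑ v ∈ S, solHit sol S v u ≤ 1 := by
  rw [← Finset.sum_coe_sort]
  refine le_of_eq_of_le (Finset.sum_congr rfl fun v _ => ?_) ((sol S).sum_hit_le_one u)
  simp [solHit]

theorem w_mul_solHit_nonneg [Fintype U] (hsol : ∀ S, (sol S).IsOptimal) (S : Finset V) (v : V) (u : U) :
    0 ≤ G.w u v * solHit sol S v u := by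
  unfold solHit
  split_ifs with h
  · exact (hsol S).w_mul_hit_nonneg ⟨v, h⟩ u
  · simp

/-- Restricting `s` to `S` drops nonnegative terms from the matching constraints, so it is feasible
for `G.induce S` and cannot beat the optimal `sol S`. -/
theorem sum_le_sum_solHit [Fintype U] [Fintype V] (hsol : ∀ S, (sol S).IsOptimal) (s : G.LPSolution) (S : Finset V) :
    ∑ v ∈ S, ∑ u, G.w u v * s.hit v u ≤ ∑ v ∈ S, ∑ u, G.w u v * solHit sol S v u := by
  obtain ⟨s', hs'⟩ := LPSolution.exists_of_mem_hitHull (G := G.induce S)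
    (fun v u => s.hit v u) (fun v => s.hit_mem_hitHull v) fun u => by
      rw [Finset.sum_coe_sort S fun v => s.hit v u]
      exact (Finset.sum_le_univ_sum_of_nonneg fun v => s.hit_nonneg v u).trans
        (s.sum_hit_le_one u)
  have h := hsol S s'
  rw [LPSolution.objective_eq, LPSolution.objective_eq] at h
  rw [← Finset.sum_coe_sort S, ← Finset.sum_coe_sort S]
  simp only [hs'] at h
  refine h.trans_eq (Finset.sum_congr rfl fun v _ => Finset.sum_congr rfl fun u _ => ?_)
  simp [solHit, induce]

/-- Arrival `i` is uniform in the arrived set, where `sol` does at least as well as the restricted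
`s`; averaging `s` over a uniform vertex then gives its objective divided by the number of vertices.
-/
theorem objective_le_card_mul_mean [Fintype U] [Fintype V] (hsol : ∀ S, (sol S).IsOptimal) (s : G.LPSolution)
    (i : Fin (Fintype.card V)) :
    s.objective ≤ Fintype.card V * ∑ u, (randomOrder V).mean fun σ =>
      G.w u (σ i) * solHit sol (arrived σ i) (σ i) u := by
  have h1 := randomOrder_mean_mul_arrival i (fun _ => 1) (fun _ _ _ => rfl)
    fun S v => ∑ u, G.w u v * solHit sol S v u
  have h2 := randomOrder_mean_mul_arrival i (fun _ => 1) (fun _ _ _ => rfl)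
    fun _ v => ∑ u, G.w u v * s.hit v u
  simp only [one_mul] at h1 h2
  have h3 := (randomOrder V).mean_mono fun σ => sum_le_sum_solHit hsol s (arrived σ i)
  rw [← h1, ← h2] at h3
  have h4 := le_of_mul_le_mul_left h3 (by positivity)
  rw [s.objective_eq, ← randomOrder_mean_apply i, ← PMF.mean_sum]
  exact mul_le_mul_of_nonneg_left h4 (Nat.cast_nonneg _)

/-- The shift by one converts arrival numbers `t = i + 1` to indices; truncated subtraction is
harmless, since a floor of 0 or 1 leaves no skipped arrival. -/
theorem meanProposalProb_eq [Fintype V] (σ : Fin (Fintype.card V) ≃ V) (i : Fin (Fintype.card V)) (u : U) :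
    G.meanProposalProb sol σ i u =
      if ⌊(Fintype.card V : ℝ) / Real.exp 1⌋₊ - 1 ≤ i.val then
        solHit sol (arrived σ i) (σ i) u else 0 := by
  unfold meanProposalProb solHit
  rw [dif_pos (mem_arrived σ i)]
  split_ifs <;> first | rfl | omega

theorem expectedWeight_onlineMatchingROM_eq [Fintype U] [Fintype V] :
    G.expectedWeight (G.onlineMatchingROM sol) =
      ∑ i : Fin (Fintype.card V) with ⌊(Fintype.card V : ℝ) / Real.exp 1⌋₊ - 1 ≤ i.val,
        ∑ u, (randomOrder V).mean fun σ => G.w u (σ i) * solHit sol (arrived σ i) (σ i) u *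
          ∏ j : Fin (Fintype.card V) with
            ⌊(Fintype.card V : ℝ) / Real.exp 1⌋₊ - 1 ≤ j.val ∧ j.val < i.val,
            (1 - solHit sol (arrived σ j) (σ j) u) := by
  rw [expectedWeight_onlineMatchingROM, PMF.mean_sum, Finset.sum_filter]
  refine Finset.sum_congr rfl fun i _ => ?_
  split_ifs with hi
  · rw [PMF.mean_sum]
    refine Finset.sum_congr rfl fun u _ => ?_
    congr 1
    ext σ
    rw [meanProposalProb_eq, if_pos hi, mul_assoc]
    congr 2
    rw [Finset.prod_filter, Finset.prod_filter]
    refine Finset.prod_congr rfl fun j _ => ?_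
    rw [meanProposalProb_eq]
    split_ifs <;> first | rfl | omega | simp
  · simp [meanProposalProb_eq, hi, PMF.mean_const]

end Online

theorem le_expectedWeight_onlineMatchingROM {U V : Type*} [Fintype U] [Fintype V] [DecidableEq U]
    [DecidableEq V] [Nonempty V] (G : StochasticGraph U V)
    (sol : ∀ S : Finset V, (G.induce S).LPSolution) (hsol : ∀ S, (sol S).IsOptimal) :
    (1 / Real.exp 1 - 1 / (Fintype.card V : ℝ)) * G.OPT ≤
      G.expectedWeight (G.onlineMatchingROM sol) := by
  rw [expectedWeight_onlineMatchingROM_eq]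
  set n := Fintype.card V
  set a := ⌊(n : ℝ) / Real.exp 1⌋₊ - 1 with ha
  have hn : 0 < n := Fintype.card_pos
  have hn' : (0 : ℝ) < n := by exact_mod_cast hn
  have he := Real.exp_pos 1
  obtain ⟨s, hs⟩ := G.exists_isOptimal
  have hD0 : 0 ≤ G.OPT / n := div_nonneg OPT_nonneg hn'.le
  let Y : Fin n → U → ℝ := fun i u => (randomOrder V).mean fun σ =>
    G.w u (σ i) * solHit sol (arrived σ i) (σ i) u
  let T : Fin n → U → ℝ := fun i u => (randomOrder V).mean fun σ =>
    G.w u (σ i) * solHit sol (arrived σ i) (σ i) u *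
      ∏ j : Fin n with a ≤ j.val ∧ j.val < i.val, (1 - solHit sol (arrived σ j) (σ j) u)
  have hY : ∀ i, G.OPT / n ≤ ∑ u, Y i u := fun i => by
    rw [div_le_iff₀' hn']
    exact (OPT_le_of_isOptimal hs).trans (objective_le_card_mul_mean hsol s i)
  have hT0 : ∀ i u, 0 ≤ T i u := fun i u => PMF.mean_nonneg _ fun σ =>
    mul_nonneg (w_mul_solHit_nonneg hsol _ _ u)
      (Finset.prod_nonneg fun j _ => sub_nonneg.2 (solHit_le_one _ _ u))
  have hT : ∀ i u, a ≤ i.val → a * Y i u ≤ i.val * T i u := fun i u hi =>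
    randomOrder_mean_mul_prod_ge i (fun S v => G.w u v * solHit sol S v u)
      (fun S v => solHit sol S v u) (fun S v _ => w_mul_solHit_nonneg hsol S v u)
      (fun S v _ => solHit_le_one S v u) (fun S => sum_solHit_le_one S u) a hi
  change _ ≤ ∑ i : Fin n with a ≤ i.val, ∑ u, T i u
  have hOPT : (1 / Real.exp 1 - 1 / (n : ℝ)) * G.OPT = (n / Real.exp 1 - 1) * (G.OPT / n) := by
    field_simp
  rw [hOPT]
  rcases Nat.eq_zero_or_pos a with h0 | hpos
  -- If `a = 0`, then `n/e < 2`, and the first arrival alone suffices: it meets no conflict and is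
  -- worth at least `OPT / n`. The factor `a / i` would be useless here.
  · have h1 : (n / Real.exp 1 - 1) * (G.OPT / n) ≤ 1 * (G.OPT / n) := by
      refine mul_le_mul_of_nonneg_right ?_ hD0
      have h2 := Nat.lt_floor_add_one ((n : ℝ) / Real.exp 1)
      have h3 : (⌊(n : ℝ) / Real.exp 1⌋₊ : ℝ) ≤ 1 := by
        have : ⌊(n : ℝ) / Real.exp 1⌋₊ ≤ 1 := by omega
        exact_mod_cast this
      linarith
    rw [one_mul] at h1
    refine h1.trans ((hY ⟨0, hn⟩).trans ?_)
    have h4 : ∀ u, Y ⟨0, hn⟩ u = T ⟨0, hn⟩ u := fun u => by simp [Y, T]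
    rw [Finset.sum_congr rfl fun u _ => h4 u]
    exact Finset.single_le_sum (f := fun i => ∑ u, T i u)
      (fun i _ => Finset.sum_nonneg fun u _ => hT0 i u) (by simp [h0])
  · have hm : ((a + 1 : ℕ) : ℝ) ≤ n / Real.exp 1 := by
      rw [ha, Nat.sub_add_cancel (by omega)]
      exact Nat.floor_le (by positivity)
    have hm' : (n : ℝ) / Real.exp 1 < ((a + 2 : ℕ) : ℝ) := by
      have := Nat.lt_floor_add_one ((n : ℝ) / Real.exp 1)
      refine this.trans_eq ?_
      have : ⌊(n : ℝ) / Real.exp 1⌋₊ + 1 = a + 2 := by omega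
      exact_mod_cast this
    rw [le_div_iff₀ he] at hm
    rw [div_lt_iff₀ he] at hm'
    push_cast at hm hm'
    have h1 := mul_le_mul_of_nonneg_right (div_exp_sub_one_le_mul_sum_Ico hpos hm hm') hD0
    refine h1.trans ?_
    have h2 : ∑ i ∈ Finset.Ico a n, 1 / (i : ℝ) = ∑ i : Fin n with a ≤ i.val, 1 / (i.val : ℝ) := by
      rw [Finset.sum_filter, Fin.sum_univ_eq_sum_range (fun i => if a ≤ i then 1 / (i : ℝ) else 0),
        ← Finset.sum_filter]
      refine Finset.sum_congr ?_ fun _ _ => rfl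
      ext i
      simp [and_comm]
    rw [h2, Finset.mul_sum, Finset.sum_mul]
    refine Finset.sum_le_sum fun i hi => ?_
    have hi : a ≤ i.val := (Finset.mem_filter.1 hi).2
    have hi0 : (0 : ℝ) < i.val := by exact_mod_cast hpos.trans_le hi
    -- The survival bound is applied for each offline vertex separately, where the terms are
    -- nonnegative, and only then summed.
    have h3 : (a : ℝ) * ∑ u, Y i u ≤ i.val * ∑ u, T i u := by
      rw [Finset.mul_sum, Finset.mul_sum]
      exact Finset.sum_le_sum fun u _ => hT i u hi
    have h4 := mul_le_mul_of_nonneg_left (hY i) (Nat.cast_nonneg (α := ℝ) a)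
    rw [mul_one_div, div_mul_eq_mul_div, div_le_iff₀' hi0]
    exact h4.trans h3

end StochasticGraph

theorem mainTheorem6 {U V : Type*} [Fintype U] [Fintype V] [DecidableEq U] [DecidableEq V]
    [Nonempty V] (G : StochasticGraph U V)
    (sol : ∀ S : Finset V, (G.induce S).LPSolution) (hsol : ∀ S, (sol S).IsOptimal) :
    (∀ (σ : Fin (Fintype.card V) ≃ V) (st : U × V → Bool),
      ∀ M ∈ (G.onlineMatching sol σ st).support, IsMatching M ∧ ∀ e ∈ M, st e = true) ∧
    (1 / Real.exp 1 - 1 / (Fintype.card V : ℝ)) * G.OPT ≤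
      G.expectedWeight (G.onlineMatchingROM sol) :=
  ⟨G.onlineMatching_support sol, G.le_expectedWeight_onlineMatchingROM sol hsol⟩
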